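/- **Setting.** Let $N\ge 2$, $0\le\eta_m<\tau_M$. Let $A,A_1\in\mathbb R^{n\times n}$, $B_i\in\mathbb R^{n\times n_i}$, $C_i\in\mathbb R^{n_i\times n}$ $(i=1,\dots,N)$, $D\in\mathbb R^{n\times q}$ (for the static output feedback $K=[K_1\ \cdots\ K_N]$ of $\dot x=Ax+Bu+D\omega$, $y_i=C_ix$, one has $A_1=\sum_i BK_iC_i$ and $B_i=BK_i$). Consider all sampling instants $0=s_0<s_1<\cdots$, $s_k\to\infty$, and delays $\eta_k\ge\eta_m$ such that the updating instants $t_k=s_k+\eta_k$ satisfy $t_k\le t_{k+1}$ and $t_{k+1}-t_k+\eta_k\le\tau_M$. The hybrid system with state $x(t)\in\mathbb R^n$ and errors $e_i(t)\in\mathbb R^{n_i}$, where $e_i$ is constant on $[t_k,t_{k+1})$, is $$\dot x(t)=Ax(t)+A_1x(s_k)+\sum_{i\ne i_k^*}B_ie_i(t)+D\omega(t)\quad\text{for a.e. } t\in[t_k,t_{k+1}),\ k\ge 0,$$ with $x$ locally absolutely continuous (no jumps), and with the resets $$e_i(t_{k+1})=C_i[x(s_k)-x(s_{k+1})]\ (i=i_k^*),\qquad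 e_i(t_{k+1})=e_i(t_k)+C_i[x(s_k)-x(s_{k+1})]\ (i\neq i_k^*).$$ The active node $i_k^*$ is chosen by the weighted TOD protocol with weights $Q_i>0$: $i_k^*$ is any index with $e_{i_k^*}^TQ_{i_k^*}e_{i_k^*}\ge e_i^TQ_ie_i$ for all $i$, at time $t_k$. (If $t_k=t_{k+1}$, the resets and the protocol are applied successively, $e(t_k)$ denoting the value after the $k$-th update.) The initial data are an arbitrary $e(t_0)$ and an initial function $x_{t_0}(\theta)=x(t_0+\theta)$, $\theta\in[-\tau_M,0]$, that is absolutely continuous with square integrable derivative; its norm is $\|x_{t_0}\|_W=\max_\theta|x_{t_0}(\theta)|+\big(\int_{-\tau_M}^0|\dot x_{t_0}|^2\big)^{1/2}$. The disturbance $\omega$ is measurable and essentially bounded on $[0,\infty)$. **Matrix inequalities.** For $\alpha\ge0$ consider the conditions on a scalar $b>0$, $n\times n$ matrices $P,S_0,R_0,S_1,R_1>0$ and $S_{12}$, and $n_i\times n_i$ matrices $Q_i,U_i,G_i>0$ ($>0$ means symmetric positive definite; $*$ denotes the symmetric block): $$\begin{bmatrix}-\frac{1-2\alpha(\tau_M-\eta_m)}{N-1}Q_i+U_i&Q_i\\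 *&Q_i-G_ie^{-2\alpha\tau_M}\end{bmatrix}<0\ (i=1,\dots,N),\qquad \Phi=\begin{bmatrix}R_1&S_{12}\\ *&R_1\end{bmatrix}\ge0,$$ $$\begin{bmatrix}\Sigma_i-F_i^T\Phi F_i\,e^{-2\alpha\tau_M}&\Xi_i^TH\\ *&-H\end{bmatrix}<0\ (i=1,\dots,N).$$ Here, with column blocks of sizes $n,n,n,n,(n_j)_{j\ne i},q$, $$\Xi_i=[A\ \ 0\ \ A_1\ \ 0\ \ (B_j)_{j\ne i}\ \ D],\quad F_{1i}=[I\ 0\ 0\ 0\ 0\ 0],\quad F_{2i}=[I\ {-I}\ 0\ 0\ 0\ 0],\quad F_i=\begin{bmatrix}0&I&-I&0&0&0\\0&0&I&-I&0&0\end{bmatrix},$$ $$H=\eta_m^2R_0+(\tau_M-\eta_m)^2R_1+(\tau_M-\eta_m)\sum_{l=1}^NC_l^TG_lC_l,$$ $$\Sigma_i=F_{1i}^TP\,\Xi_i+\Xi_i^TPF_{1i}+\Upsilon_i-F_{2i}^TR_0F_{2i}\,e^{-2\alpha\eta_m},$$ $$\Upsilon_i=\mathrm{diag}\{S_0+2\alpha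 P,\ -(S_0-S_1)e^{-2\alpha\eta_m},\ 0,\ -S_1e^{-2\alpha\tau_M},\ (\psi_j)_{j\ne i},\ -bI_q\},\qquad \psi_j=-\tfrac1{\tau_M-\eta_m}U_j+2\alpha Q_j.$$ **Lyapunov functional.** For $t\in[t_k,t_{k+1})$ put $$\begin{aligned}V(t)={}&x^T(t)Px(t)+\int_{t-\eta_m}^te^{2\alpha(s-t)}x^T(s)S_0x(s)\,ds+\int_{t-\tau_M}^{t-\eta_m}e^{2\alpha(s-t)}x^T(s)S_1x(s)\,ds\\&+\eta_m\int_{-\eta_m}^0\int_{t+\theta}^te^{2\alpha(s-t)}\dot x^T(s)R_0\dot x(s)\,ds\,d\theta+(\tau_M-\eta_m)\int_{-\tau_M}^{-\eta_m}\int_{t+\theta}^te^{2\alpha(s-t)}\dot x^T(s)R_1\dot x(s)\,ds\,d\theta\\&+\sum_{i=1}^N(\tau_M-\eta_m)\int_{s_k}^te^{2\alpha(s-t)}\dot x^T(s)C_i^TG_iC_i\dot x(s)\,ds,\end{aligned}$$ and let $V_e(t_0)=V(t_0)+\sum_{i}e_i^T(t_0)Q_ie_i(t_0)$, where $V(t_0)$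 is given by this formula with $t=t_0$, $k=0$. **Theorem.** (a) If the matrix inequalities hold for some $\alpha>0$, then every solution of the hybrid system under the TOD protocol with the weights $Q_i$, for every $\Delta$ with $|\omega(t)|\le\Delta$ for a.e. $t\ge0$, satisfies $$V(t)\le e^{-2\alpha(t-t_0)}V_e(t_0)+\frac b{2\alpha}\Delta^2,\qquad t\ge t_0.\tag{1}$$ Moreover the system is ISS with respect to the full state $(x,e)$: there are $\beta,\delta,c>0$, the same for all admissible $(s_k),(\eta_k),\omega$ and all solutions, such that $|x(t)|^2$ and $|e(t)|^2$ are both at most $$\beta e^{-\delta(t-t_0)}\big[\|x_{t_0}\|_W^2+|e(t_0)|^2\big]+c\,\operatorname*{ess\,sup}_{s\in[t_0,t]}|\omega(s)|^2,\qquad t\ge t_0.$$ (b) If the matrix inequalities hold with $\alpha=0$, then there is $\alpha_0>0$ such that, with the same matrices and the same $b$, (1) holds with every $\alpha\in(0,\alpha_0]$ (also in the definition of $V$), and the system is ISS in the same sense. -/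

import Mathlib

open MeasureTheory Matrix

namespace NCS

/-- The quadratic form `vᵀ M v`; for `M > 0` this is `|√M v|²`. -/
def quad {m : ℕ} (M : Matrix (Fin m) (Fin m) ℝ) (v : EuclideanSpace ℝ (Fin m)) : ℝ :=
  v.ofLp ⬝ᵥ (M *ᵥ v.ofLp)

/-- The matrices of the closed-loop hybrid model with state dimension `n`, disturbance
dimension `q` and `N` sensor nodes, the `i`-th one having an output of dimension `p i`.
(For the static output feedback `K = [K₁ ⋯ K_N]` and the plant `ẋ = A x + B u + D ω`
one has `A₁ = B K C` and `B i = B Kᵢ`.) -/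
structure Plant {N : ℕ} (n q : ℕ) (p : Fin N → ℕ) where
  A : Matrix (Fin n) (Fin n) ℝ
  A₁ : Matrix (Fin n) (Fin n) ℝ
  B : (i : Fin N) → Matrix (Fin n) (Fin (p i)) ℝ
  C : (i : Fin N) → Matrix (Fin (p i)) (Fin n) ℝ
  D : Matrix (Fin n) (Fin q) ℝ

/-- Sampling instants `s k` and network-induced delays `η k`. The lower delay bound is `ηm`,
and `τM` bounds the time from a sampling instant to the next update. The last field says
that an older sample does not arrive after a more recent one. -/
structure Sampling (ηm τM : ℝ) where
  s : ℕ → ℝ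
  η : ℕ → ℝ
  s_zero : s 0 = 0
  s_strictMono : StrictMono s
  s_unbounded : Filter.Tendsto s Filter.atTop Filter.atTop
  le_delay : ∀ k, ηm ≤ η k
  span_le : ∀ k, (s (k + 1) + η (k + 1)) - (s k + η k) + η k ≤ τM
  ordered : ∀ k, s k + η k ≤ s (k + 1) + η (k + 1)

/-- The updating instants `t k = s k + η k`. -/
def Sampling.t {ηm τM : ℝ} (σ : Sampling ηm τM) (k : ℕ) : ℝ := σ.s k + σ.η k

/-- `x`, `e`, `act` solve the hybrid model under the weighted TOD protocol with weights `Q`,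
for the disturbance `ω`. Here `e k i` is the value that the piecewise constant error `e_i(·)`
takes at `t k` and keeps on `[t k, t (k+1))` (that is, `ė = 0` between updates), and `act k`
is the node that is active at the sampling instant `s k`. The function `x` is
considered on `[t 0 - τM, ∞)` only, its restriction to `[t 0 - τM, t 0]` being the initial
function; `e 0` is the initial error. -/
structure IsSolution {N n q : ℕ} {p : Fin N → ℕ} (sys : Plant n q p) {ηm τM : ℝ}
    (Q : (i : Fin N) → Matrix (Fin (p i)) (Fin (p i)) ℝ) (σ : Sampling ηm τM)
    (ω : ℝ → EuclideanSpace ℝ (Fin q)) (x : ℝ → EuclideanSpace ℝ (Fin n))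
    (e : ℕ → (i : Fin N) → EuclideanSpace ℝ (Fin (p i))) (act : ℕ → Fin N) : Prop where
  /-- The disturbance is measurable and essentially bounded on `[0, ∞)`. -/
  disturbance : MemLp ω ⊤ (volume.restrict (Set.Ici (0 : ℝ)))
  /-- `x` is locally absolutely continuous on `[t 0 - τM, ∞)`; in particular, it does not jump
  at the updating instants. -/
  absCont : ∀ T, σ.t 0 ≤ T → AbsolutelyContinuousOnInterval x (σ.t 0 - τM) T
  /-- The initial function has a square integrable derivative. -/
  initial : MemLp (deriv x) 2 (volume.restrict (Set.Icc (σ.t 0 - τM) (σ.t 0)))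
  /-- The continuous dynamics on `[t k, t (k+1))`. -/
  flow : ∀ k, ∀ᵐ t : ℝ, t ∈ Set.Ico (σ.t k) (σ.t (k + 1)) →
    HasDerivAt x (sys.A.toEuclideanLin (x t) + sys.A₁.toEuclideanLin (x (σ.s k))
      + ∑ i ∈ Finset.univ.erase (act k), (sys.B i).toEuclideanLin (e k i)
      + sys.D.toEuclideanLin (ω t)) t
  /-- The reset of the active node. -/
  reset_active : ∀ k, e (k + 1) (act k) =
    (sys.C (act k)).toEuclideanLin (x (σ.s k) - x (σ.s (k + 1)))
  /-- The reset of the other nodes. -/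
  reset_inactive : ∀ k i, i ≠ act k → e (k + 1) i =
    e k i + (sys.C i).toEuclideanLin (x (σ.s k) - x (σ.s (k + 1)))
  /-- The weighted Try-Once-Discard protocol. -/
  tod : ∀ k i, quad (Q i) (e k i) ≤ quad (Q (act k)) (e k (act k))

/-- The decision variables of the matrix inequalities. -/
structure DecisionVars {N : ℕ} (n : ℕ) (p : Fin N → ℕ) where
  b : ℝ
  P : Matrix (Fin n) (Fin n) ℝ
  S₀ : Matrix (Fin n) (Fin n) ℝ
  R₀ : Matrix (Fin n) (Fin n) ℝ
  S₁ : Matrix (Fin n) (Fin n) ℝ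
  R₁ : Matrix (Fin n) (Fin n) ℝ
  S₁₂ : Matrix (Fin n) (Fin n) ℝ
  Q : (i : Fin N) → Matrix (Fin (p i)) (Fin (p i)) ℝ
  U : (i : Fin N) → Matrix (Fin (p i)) (Fin (p i)) ℝ
  G : (i : Fin N) → Matrix (Fin (p i)) (Fin (p i)) ℝ

section LMI

variable {N n q : ℕ} {p : Fin N → ℕ} (sys : Plant n q p) (ηm τM α : ℝ) (d : DecisionVars n p)

/-- Index type of the vector
`ξ_i = col{x(t), x(t-ηm), x(t-τ(t)), x(t-τM), e_j(t) (j ≠ i), ω(t)}`. -/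
abbrev XiIdx (n q : ℕ) (p : Fin N → ℕ) (i : Fin N) : Type :=
  Fin n ⊕ (Fin n ⊕ (Fin n ⊕ (Fin n ⊕ (((j : {j : Fin N // j ≠ i}) × Fin (p j)) ⊕ Fin q))))

/-- `Ω_i`. -/
noncomputable def Omega (i : Fin N) : Matrix (Fin (p i) ⊕ Fin (p i)) (Fin (p i) ⊕ Fin (p i)) ℝ :=
  fromBlocks (-((1 - 2 * α * (τM - ηm)) / ((N : ℝ) - 1)) • d.Q i + d.U i) (d.Q i)
    (d.Q i)ᵀ (d.Q i - Real.exp (-2 * α * τM) • d.G i)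

/-- `Φ`. -/
def Phi : Matrix (Fin n ⊕ Fin n) (Fin n ⊕ Fin n) ℝ :=
  fromBlocks d.R₁ d.S₁₂ d.S₁₂ᵀ d.R₁

/-- `H`. -/
def HMat : Matrix (Fin n) (Fin n) ℝ :=
  ηm ^ 2 • d.R₀ + (τM - ηm) ^ 2 • d.R₁ + (τM - ηm) • ∑ l, (sys.C l)ᵀ * d.G l * sys.C l

/-- `F₁ = [I 0]`. -/
def F₁ (n q : ℕ) (p : Fin N → ℕ) (i : Fin N) : Matrix (Fin n) (XiIdx n q p i) ℝ :=
  fromCols 1 0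

/-- `F₂ = [I -I 0]`. -/
def F₂ (n q : ℕ) (p : Fin N → ℕ) (i : Fin N) : Matrix (Fin n) (XiIdx n q p i) ℝ :=
  fromCols 1 (fromCols (-1) 0)

/-- `F = [0 I -I 0 0; 0 0 I -I 0]`. -/
def FMat (n q : ℕ) (p : Fin N → ℕ) (i : Fin N) : Matrix (Fin n ⊕ Fin n) (XiIdx n q p i) ℝ :=
  fromRows (fromCols 0 (fromCols 1 (fromCols (-1) 0)))
    (fromCols 0 (fromCols 0 (fromCols 1 (fromCols (-1) 0))))

/-- The block row `[B_j]` over all `j ≠ i`. -/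
def BRow (i : Fin N) : Matrix (Fin n) ((j : {j : Fin N // j ≠ i}) × Fin (p j)) ℝ :=
  Matrix.of fun r c => sys.B c.1 r c.2

/-- `Ξ_i = [A 0 A₁ 0 (B_j)_{j ≠ i} D]`. -/
def Xi (i : Fin N) : Matrix (Fin n) (XiIdx n q p i) ℝ :=
  fromCols sys.A (fromCols 0 (fromCols sys.A₁ (fromCols 0 (fromCols (BRow sys i) sys.D))))

/-- `ψ_j`. -/
noncomputable def psi (j : Fin N) : Matrix (Fin (p j)) (Fin (p j)) ℝ :=
  -(1 / (τM - ηm)) • d.U j + (2 * α) • d.Q j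

/-- The block diagonal matrix `Υ_i`. -/
noncomputable def Upsilon (i : Fin N) : Matrix (XiIdx n q p i) (XiIdx n q p i) ℝ :=
  fromBlocks (d.S₀ + (2 * α) • d.P) 0 0
    (fromBlocks (-(Real.exp (-2 * α * ηm) • (d.S₀ - d.S₁))) 0 0
      (fromBlocks 0 0 0
        (fromBlocks (-(Real.exp (-2 * α * τM) • d.S₁)) 0 0
          (fromBlocks (blockDiagonal' fun j : {j : Fin N // j ≠ i} => psi ηm τM α d j) 0 0
            (-(d.b • (1 : Matrix (Fin q) (Fin q) ℝ)))))))

/-- `Σ_i`. -/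
noncomputable def SigmaMat (i : Fin N) : Matrix (XiIdx n q p i) (XiIdx n q p i) ℝ :=
  (F₁ n q p i)ᵀ * d.P * Xi sys i + (Xi sys i)ᵀ * d.P * F₁ n q p i + Upsilon ηm τM α d i
    - Real.exp (-2 * α * ηm) • ((F₂ n q p i)ᵀ * d.R₀ * F₂ n q p i)

/-- The left-hand side of the second matrix inequality. -/
noncomputable def LMIMat (i : Fin N) : Matrix (XiIdx n q p i ⊕ Fin n) (XiIdx n q p i ⊕ Fin n) ℝ :=
  fromBlocks
    (SigmaMat sys ηm τM α d i - Real.exp (-2 * α * τM) • ((FMat n q p i)ᵀ * Phi d * FMat n q p i))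
    ((Xi sys i)ᵀ * HMat sys ηm τM d)
    ((Xi sys i)ᵀ * HMat sys ηm τM d)ᵀ
    (-(HMat sys ηm τM d))

/-- The decision variables `d` satisfy all the required matrix inequalities with the decay
rate `α`. -/
structure Feasible : Prop where
  b_pos : 0 < d.b
  P_pos : d.P.PosDef
  S₀_pos : d.S₀.PosDef
  R₀_pos : d.R₀.PosDef
  S₁_pos : d.S₁.PosDef
  R₁_pos : d.R₁.PosDef
  Q_pos : ∀ i, (d.Q i).PosDef
  U_pos : ∀ i, (d.U i).PosDef
  G_pos : ∀ i, (d.G i).PosDef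
  Omega_neg : ∀ i, (-(Omega ηm τM α d i)).PosDef
  Phi_nonneg : (Phi d).PosSemidef
  LMI_neg : ∀ i, (-(LMIMat sys ηm τM α d i)).PosDef

/-- The part `Ṽ(t, x_t, ẋ_t)` of the Lyapunov functional. -/
noncomputable def VTilde (x : ℝ → EuclideanSpace ℝ (Fin n)) (t : ℝ) : ℝ :=
  quad d.P (x t)
  + (∫ s in (t - ηm)..t, Real.exp (2 * α * (s - t)) * quad d.S₀ (x s))
  + (∫ s in (t - τM)..(t - ηm), Real.exp (2 * α * (s - t)) * quad d.S₁ (x s))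
  + ηm * (∫ θ in (-ηm)..0, ∫ s in (t + θ)..t,
      Real.exp (2 * α * (s - t)) * quad d.R₀ (deriv x s))
  + (τM - ηm) * (∫ θ in (-τM)..(-ηm), ∫ s in (t + θ)..t,
      Real.exp (2 * α * (s - t)) * quad d.R₁ (deriv x s))

/-- The part `V_G` of the Lyapunov functional, on an interval `[t k, t (k+1))`, where `sk` is
the sampling instant `s k`. -/
noncomputable def VG (x : ℝ → EuclideanSpace ℝ (Fin n)) (sk t : ℝ) : ℝ :=
  ∑ i, (τM - ηm) * ∫ s in sk..t,
    Real.exp (2 * α * (s - t)) * quad (d.G i) ((sys.C i).toEuclideanLin (deriv x s))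

/-- `V = Ṽ + V_G`. -/
noncomputable def V (x : ℝ → EuclideanSpace ℝ (Fin n)) (sk t : ℝ) : ℝ :=
  VTilde ηm τM α d x t + VG sys ηm τM α d x sk t

/-- `V_e = V + ∑ e_iᵀ Q_i e_i`. -/
noncomputable def Ve (x : ℝ → EuclideanSpace ℝ (Fin n)) (sk t : ℝ)
    (ek : (i : Fin N) → EuclideanSpace ℝ (Fin (p i))) : ℝ :=
  V sys ηm τM α d x sk t + ∑ i, quad (d.Q i) (ek i)

/-- The exponential bound on `V` along all solutions of the hybrid system under the TOD
protocol with the weights `d.Q`, for all admissible sampling instants, delays and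
disturbances. -/
def ExpBound : Prop :=
  ∀ (σ : Sampling ηm τM) (ω : ℝ → EuclideanSpace ℝ (Fin q)) (x : ℝ → EuclideanSpace ℝ (Fin n))
    (e : ℕ → (i : Fin N) → EuclideanSpace ℝ (Fin (p i))) (act : ℕ → Fin N),
    IsSolution sys d.Q σ ω x e act →
    ∀ Δ : ℝ, (∀ᵐ t : ℝ, 0 ≤ t → ‖ω t‖ ≤ Δ) →
    ∀ k t, t ∈ Set.Ico (σ.t k) (σ.t (k + 1)) →
      V sys ηm τM α d x (σ.s k) t
        ≤ Real.exp (-2 * α * (t - σ.t 0)) * Ve sys ηm τM α d x (σ.s 0) (σ.t 0) (e 0)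
          + d.b / (2 * α) * Δ ^ 2

end LMI

/-- The norm of `W[-τM, 0]` of the function `θ ↦ x (t₀ + θ)`. -/
noncomputable def normW {n : ℕ} (x : ℝ → EuclideanSpace ℝ (Fin n)) (τM t₀ : ℝ) : ℝ :=
  sSup ((fun s => ‖x s‖) '' Set.Icc (t₀ - τM) t₀) + √(∫ s in (t₀ - τM)..t₀, ‖deriv x s‖ ^ 2)

/-- The essential supremum of `|ω|` on `[t₀, t]`. -/
noncomputable def essNorm {q : ℕ} (ω : ℝ → EuclideanSpace ℝ (Fin q)) (t₀ t : ℝ) : ℝ :=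
  (eLpNorm ω ⊤ (volume.restrict (Set.Icc t₀ t))).toReal

/-- Input-to-state stability with respect to the full state `(x, e)` of the hybrid system under
the TOD protocol with the weights `Q`; the constants are uniform over all admissible sampling
instants, delays, disturbances and initial data. -/
def ISS {N n q : ℕ} {p : Fin N → ℕ} (sys : Plant n q p) (ηm τM : ℝ)
    (Q : (i : Fin N) → Matrix (Fin (p i)) (Fin (p i)) ℝ) : Prop :=
  ∃ β > 0, ∃ δ > 0, ∃ c > 0,
    ∀ (σ : Sampling ηm τM) (ω : ℝ → EuclideanSpace ℝ (Fin q))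
      (x : ℝ → EuclideanSpace ℝ (Fin n))
      (e : ℕ → (i : Fin N) → EuclideanSpace ℝ (Fin (p i))) (act : ℕ → Fin N),
      IsSolution sys Q σ ω x e act →
      (∀ t, σ.t 0 ≤ t →
        ‖x t‖ ^ 2 ≤ β * Real.exp (-δ * (t - σ.t 0))
            * (normW x τM (σ.t 0) ^ 2 + ∑ i, ‖e 0 i‖ ^ 2) + c * essNorm ω (σ.t 0) t ^ 2) ∧
      (∀ k t, t ∈ Set.Ico (σ.t k) (σ.t (k + 1)) →
        ∑ i, ‖e k i‖ ^ 2 ≤ β * Real.exp (-δ * (t - σ.t 0))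
            * (normW x τM (σ.t 0) ^ 2 + ∑ i, ‖e 0 i‖ ^ 2) + c * essNorm ω (σ.t 0) t ^ 2)

end NCS

namespace NCS

/-! The functional $V_e = V + \sum_i e_i^T Q_i e_i$ contracts from one updating instant to the next,
up to the disturbance: with $E_k = e^{-2\alpha(t_{k+1}-t_k)}$, one has $V_e(t_{k+1}) \le E_k
V_e(t_k) + \frac{b}{2\alpha}\Delta^2(1-E_k)$ (`Ve_succ_le`), and these bounds compose to (1).

Flow. Since $\dot x$ is only square integrable, $V$ is not differentiated pointwise. The increment
of $e^{2\alpha t}V(t)$ is written as the integral of `growthRate`. Jensen's inequality and the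
reciprocally convex combination bound the integral terms of this rate, and the second matrix
inequality at $\xi_i$ then bounds the rate by $e^{2\alpha t}\big[\sum_{j\ne
i}(\frac{1}{\tau_M-\eta_m}e_j^TU_je_j - 2\alpha e_j^TQ_je_j) + b|\omega|^2\big]$ (`growthRate_le`).
After integration the errors of the inactive nodes decay at the rate $2\alpha$, at the cost of at
most one term $\sum_{j\ne i}e_j^TU_je_j$ (`V_add_errors_le`).

Reset. At $t_{k+1}$ the lower limit of the integrals in $V_G$ jumps from $s_k$ to $s_{k+1}$. The
part that is dropped dominates $e^{-2\alpha\tau_M}\sum_i|\sqrt{G_i}C_i(x(s_k)-x(s_{k+1}))|^2$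
(`V_jump_le`). By the first matrix inequality and the TOD rule, this pays for the growth of the
errors and also for the $U_j$ terms left by the flow (`Feasible.reset_le`).

ISS follows by comparing $V$ and $V_e$ with squared norms; the decay estimates use the bound on
$\omega$ only up to the current time. For $\alpha=0$, the strict matrix inequalities depend
continuously on $\alpha$ and hence persist for small $\alpha$ (`Feasible.eventually`). -/

/-- The bilinear form `uᵀ M v`. -/
def bil {m : ℕ} (M : Matrix (Fin m) (Fin m) ℝ) (u v : EuclideanSpace ℝ (Fin m)) : ℝ :=
  u.ofLp ⬝ᵥ (M *ᵥ v.ofLp)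

/-! ### Quadratic and bilinear forms of matrices. -/

section QuadraticForms

variable {m : ℕ} {M : Matrix (Fin m) (Fin m) ℝ}

lemma dotProduct_conj_mulVec {ι κ : Type*} [Fintype ι] [Fintype κ]
    (F : Matrix κ ι ℝ) (P : Matrix κ κ ℝ) (v : ι → ℝ) :
    v ⬝ᵥ ((Fᵀ * P * F) *ᵥ v) = (F *ᵥ v) ⬝ᵥ (P *ᵥ (F *ᵥ v)) := by
  rw [Matrix.mul_assoc, ← mulVec_mulVec, ← mulVec_mulVec, dotProduct_mulVec, vecMul_transpose]

lemma bil_comm (hM : Mᵀ = M) (u v : EuclideanSpace ℝ (Fin m)) : bil M u v = bil M v u := by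
  unfold bil
  rw [dotProduct_mulVec, ← mulVec_transpose, hM, dotProduct_comm]

lemma quad_add (hM : Mᵀ = M) (u v : EuclideanSpace ℝ (Fin m)) :
    quad M (u + v) = quad M u + 2 * bil M u v + quad M v := by
  have h := bil_comm hM u v
  unfold bil at *
  simp only [quad, WithLp.ofLp_add, mulVec_add, dotProduct_add, add_dotProduct]
  linarith

lemma quad_conj {k : ℕ} (C : Matrix (Fin k) (Fin m) ℝ) (G : Matrix (Fin k) (Fin k) ℝ)
    (v : EuclideanSpace ℝ (Fin m)) : quad (Cᵀ * G * C) v = quad G (C.toEuclideanLin v) := by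
  simp [quad, dotProduct_conj_mulVec]

lemma quad_smul (c : ℝ) (v : EuclideanSpace ℝ (Fin m)) : quad M (c • v) = c ^ 2 * quad M v := by
  simp only [quad, WithLp.ofLp_smul, mulVec_smul, dotProduct_smul, smul_dotProduct, smul_eq_mul]
  ring

lemma bil_smul_left (c : ℝ) (u v : EuclideanSpace ℝ (Fin m)) :
    bil M (c • u) v = c * bil M u v := by
  simp [bil]

lemma bil_smul_right (c : ℝ) (u v : EuclideanSpace ℝ (Fin m)) :
    bil M u (c • v) = c * bil M u v := by
  simp [bil, mulVec_smul]

lemma quad_sub (hM : Mᵀ = M) (u v : EuclideanSpace ℝ (Fin m)) :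
    quad M (u - v) = quad M u - 2 * bil M u v + quad M v := by
  have h := quad_add hM u ((-1 : ℝ) • v)
  rw [bil_smul_right, quad_smul] at h
  rw [sub_eq_add_neg, ← neg_one_smul ℝ v, h]
  ring

lemma quad_nonneg (hM : M.PosSemidef) (v : EuclideanSpace ℝ (Fin m)) : 0 ≤ quad M v := by
  simpa [quad] using hM.dotProduct_mulVec_nonneg v.ofLp

@[simp] lemma quad_zero : quad M (0 : EuclideanSpace ℝ (Fin m)) = 0 := by simp [quad]

@[simp] lemma quad_neg (v : EuclideanSpace ℝ (Fin m)) : quad M (-v) = quad M v := by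
  simp [quad, mulVec_neg]

lemma continuous_quad : Continuous (quad M) := by
  unfold quad
  fun_prop

lemma posSemidef_transpose_eq (hM : M.PosSemidef) : Mᵀ = M := by
  have h := hM.isHermitian.eq
  rwa [conjTranspose_eq_transpose_of_trivial] at h

/-- A quadratic form is bounded by a multiple of the squared norm. -/
lemma exists_quad_le (M : Matrix (Fin m) (Fin m) ℝ) :
    ∃ c > 0, ∀ v : EuclideanSpace ℝ (Fin m), |quad M v| ≤ c * ‖v‖ ^ 2 := by
  refine ⟨‖M.toEuclideanLin.toContinuousLinearMap‖ + 1, by positivity, fun v => ?_⟩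
  have h1 : quad M v = inner ℝ v (M.toEuclideanLin.toContinuousLinearMap v) := by
    simp [quad, EuclideanSpace.inner_eq_star_dotProduct, dotProduct_comm]
  have h2 := abs_real_inner_le_norm v (M.toEuclideanLin.toContinuousLinearMap v)
  have h3 := M.toEuclideanLin.toContinuousLinearMap.le_opNorm v
  rw [h1]
  nlinarith [norm_nonneg v, sq_nonneg ‖v‖]

/-- A positive definite quadratic form dominates a multiple of the squared norm. -/
lemma exists_le_quad (hM : M.PosDef) :
    ∃ c > 0, ∀ v : EuclideanSpace ℝ (Fin m), c * ‖v‖ ^ 2 ≤ quad M v := by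
  have hpos : ∀ v : EuclideanSpace ℝ (Fin m), v ≠ 0 → 0 < quad M v := fun v hv => by
    simpa [quad] using hM.dotProduct_mulVec_pos (x := v.ofLp) (by simpa using hv)
  -- The unit sphere is empty in dimension zero; otherwise the constant is the minimum of the form
  -- on it.
  rcases (Metric.sphere (0 : EuclideanSpace ℝ (Fin m)) 1).eq_empty_or_nonempty with he | hne
  · refine ⟨1, one_pos, fun v => ?_⟩
    have hv : v = 0 := by
      by_contra hv
      have : ‖v‖⁻¹ • v ∈ Metric.sphere (0 : EuclideanSpace ℝ (Fin m)) 1 := by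
        simp [norm_smul, hv]
      simp [he] at this
    simp [hv]
  · obtain ⟨u, hu, hmin⟩ := (isCompact_sphere (0 : EuclideanSpace ℝ (Fin m)) 1).exists_isMinOn hne
      (continuous_quad (M := M)).continuousOn
    have hu0 : u ≠ 0 := by
      rintro rfl
      simp at hu
    refine ⟨quad M u, hpos u hu0, fun v => ?_⟩
    by_cases hv : v = 0
    · simp [hv]
    have hs : ‖v‖⁻¹ • v ∈ Metric.sphere (0 : EuclideanSpace ℝ (Fin m)) 1 := by
      simp [norm_smul, hv]
    have h := hmin hs
    simp only [Set.mem_ofPred_eq, quad_smul] at h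
    have hv' : 0 < ‖v‖ := norm_pos_iff.2 hv
    rw [inv_pow, inv_mul_eq_div, le_div_iff₀ (by positivity)] at h
    exact h

end QuadraticForms

/-! ### The matrix inequalities as inequalities between quadratic forms. -/

section MatrixInequalities

variable {N n q : ℕ} {p : Fin N → ℕ} {sys : Plant n q p} {ηm τM α : ℝ} {d : DecisionVars n p}

/-- The vector `ξ_i`. -/
def xiVec (i : Fin N) (x₀ x₁ x₂ x₃ : EuclideanSpace ℝ (Fin n))
    (e : (j : Fin N) → EuclideanSpace ℝ (Fin (p j))) (w : EuclideanSpace ℝ (Fin q)) :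
    XiIdx n q p i → ℝ :=
  Sum.elim x₀.ofLp (Sum.elim x₁.ofLp (Sum.elim x₂.ofLp (Sum.elim x₃.ofLp
    (Sum.elim (fun c : (j : {j : Fin N // j ≠ i}) × Fin (p j) => (e c.1).ofLp c.2) w.ofLp))))

variable (i : Fin N) (x₀ x₁ x₂ x₃ : EuclideanSpace ℝ (Fin n))
    (e : (j : Fin N) → EuclideanSpace ℝ (Fin (p j))) (w : EuclideanSpace ℝ (Fin q))

lemma F₁_mulVec_xiVec : F₁ n q p i *ᵥ xiVec i x₀ x₁ x₂ x₃ e w = x₀.ofLp := by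
  simp [F₁, xiVec, fromCols_mulVec]

lemma F₂_mulVec_xiVec : F₂ n q p i *ᵥ xiVec i x₀ x₁ x₂ x₃ e w = (x₀ - x₁).ofLp := by
  simp [F₂, xiVec, fromCols_mulVec, neg_mulVec, sub_eq_add_neg]

lemma FMat_mulVec_xiVec : FMat n q p i *ᵥ xiVec i x₀ x₁ x₂ x₃ e w =
    Sum.elim (x₁ - x₂).ofLp (x₂ - x₃).ofLp := by
  simp only [FMat, xiVec, fromRows_mulVec, fromCols_mulVec, Sum.elim_comp_inl, Sum.elim_comp_inr]
  simp [neg_mulVec, sub_eq_add_neg]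

lemma sum_subtype_ne {β : Type*} [AddCommMonoid β] (f : Fin N → β) :
    ∑ j : {j : Fin N // j ≠ i}, f j = ∑ j ∈ Finset.univ.erase i, f j := by
  symm
  apply Finset.sum_subtype
  simp

lemma Xi_mulVec_xiVec : Xi sys i *ᵥ xiVec i x₀ x₁ x₂ x₃ e w =
    (sys.A.toEuclideanLin x₀ + sys.A₁.toEuclideanLin x₂
      + ∑ j ∈ Finset.univ.erase i, (sys.B j).toEuclideanLin (e j)
      + sys.D.toEuclideanLin w).ofLp := by
  have hB : BRow sys i *ᵥ (fun c : (j : {j : Fin N // j ≠ i}) × Fin (p j) => (e c.1).ofLp c.2) =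
      ∑ j ∈ Finset.univ.erase i, sys.B j *ᵥ (e j).ofLp := by
    rw [← sum_subtype_ne i (fun j => sys.B j *ᵥ (e j).ofLp)]
    ext r
    simp [BRow, mulVec, dotProduct, Fintype.sum_sigma]
  simp only [Xi, xiVec, fromCols_mulVec, Sum.elim_comp_inl, Sum.elim_comp_inr, hB, zero_mulVec]
  simp [WithLp.ofLp_sum]
  abel

lemma Upsilon_form : xiVec i x₀ x₁ x₂ x₃ e w ⬝ᵥ
      (Upsilon ηm τM α d i *ᵥ xiVec i x₀ x₁ x₂ x₃ e w) =
    quad d.S₀ x₀ + 2 * α * quad d.P x₀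
      - Real.exp (-2 * α * ηm) * (quad d.S₀ x₁ - quad d.S₁ x₁)
      - Real.exp (-2 * α * τM) * quad d.S₁ x₃
      + ∑ j ∈ Finset.univ.erase i, (-(1 / (τM - ηm)) * quad (d.U j) (e j)
        + 2 * α * quad (d.Q j) (e j))
      - d.b * ‖w‖ ^ 2 := by
  have hbd : (fun c : (j : {j : Fin N // j ≠ i}) × Fin (p j) => (e c.1).ofLp c.2) ⬝ᵥ
      ((blockDiagonal' fun j : {j : Fin N // j ≠ i} => psi ηm τM α d j) *ᵥ
      (fun c : (j : {j : Fin N // j ≠ i}) × Fin (p j) => (e c.1).ofLp c.2)) =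
      ∑ j ∈ Finset.univ.erase i, (-(1 / (τM - ηm)) * quad (d.U j) (e j)
        + 2 * α * quad (d.Q j) (e j)) := by
    rw [← sum_subtype_ne i (fun j => -(1 / (τM - ηm)) * quad (d.U j) (e j)
        + 2 * α * quad (d.Q j) (e j))]
    have : ∀ j : {j : Fin N // j ≠ i}, -(1 / (τM - ηm)) * quad (d.U j) (e j)
        + 2 * α * quad (d.Q j) (e j) = (e j).ofLp ⬝ᵥ (psi ηm τM α d j *ᵥ (e j).ofLp) := by
      intro j
      simp only [psi, quad, add_mulVec, dotProduct_add, smul_mulVec, dotProduct_smul,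
        smul_eq_mul]
    simp only [this]
    simp only [dotProduct, mulVec, Fintype.sum_sigma]
    refine Finset.sum_congr rfl fun j _ => Finset.sum_congr rfl fun a _ => ?_
    congr 1
    rw [Finset.sum_eq_single j]
    · simp [blockDiagonal'_apply_eq]
    · intro k _ hk
      simp [blockDiagonal'_apply_ne _ _ _ hk.symm]
    · simp
  simp only [Upsilon, xiVec, fromBlocks_mulVec, Sum.elim_comp_inl, Sum.elim_comp_inr,
    zero_mulVec, add_zero, zero_add, sumElim_dotProduct_sumElim, hbd, dotProduct_zero]
  simp only [quad, add_mulVec, sub_mulVec, neg_mulVec, smul_mulVec, one_mulVec, dotProduct_add,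
    dotProduct_sub, dotProduct_neg, dotProduct_smul, smul_eq_mul, EuclideanSpace.real_norm_sq_eq]
  simp only [dotProduct, pow_two]
  ring

lemma Phi_form (u v : EuclideanSpace ℝ (Fin n)) :
    Sum.elim u.ofLp v.ofLp ⬝ᵥ (Phi d *ᵥ Sum.elim u.ofLp v.ofLp) =
      quad d.R₁ u + 2 * bil d.S₁₂ u v + quad d.R₁ v := by
  have h : v.ofLp ⬝ᵥ (d.S₁₂ᵀ *ᵥ u.ofLp) = u.ofLp ⬝ᵥ (d.S₁₂ *ᵥ v.ofLp) := by
    rw [dotProduct_mulVec, vecMul_transpose, dotProduct_comm]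
  simp only [Phi, fromBlocks_mulVec, Sum.elim_comp_inl, Sum.elim_comp_inr,
    sumElim_dotProduct_sumElim, dotProduct_add, h, quad, bil]
  ring

lemma HMat_form (y : EuclideanSpace ℝ (Fin n)) :
    y.ofLp ⬝ᵥ (HMat sys ηm τM d *ᵥ y.ofLp) = ηm ^ 2 * quad d.R₀ y + (τM - ηm) ^ 2 * quad d.R₁ y
      + (τM - ηm) * ∑ l, quad (d.G l) ((sys.C l).toEuclideanLin y) := by
  simp only [HMat, add_mulVec, smul_mulVec, dotProduct_add, dotProduct_smul, smul_eq_mul, quad,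
    sum_mulVec, dotProduct_sum, dotProduct_conj_mulVec]
  simp

/-- The second matrix inequality evaluated at `ξ_i`, after taking the Schur complement. -/
lemma Feasible.form_le (h : Feasible sys ηm τM α d) (y : EuclideanSpace ℝ (Fin n))
    (hy : y = sys.A.toEuclideanLin x₀ + sys.A₁.toEuclideanLin x₂
      + ∑ j ∈ Finset.univ.erase i, (sys.B j).toEuclideanLin (e j) + sys.D.toEuclideanLin w) :
    2 * α * quad d.P x₀ + 2 * bil d.P x₀ y + quad d.S₀ x₀
      - Real.exp (-2 * α * ηm) * (quad d.S₀ x₁ - quad d.S₁ x₁)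
      - Real.exp (-2 * α * τM) * quad d.S₁ x₃
      - Real.exp (-2 * α * ηm) * quad d.R₀ (x₀ - x₁)
      - Real.exp (-2 * α * τM) * (quad d.R₁ (x₁ - x₂) + 2 * bil d.S₁₂ (x₁ - x₂) (x₂ - x₃)
        + quad d.R₁ (x₂ - x₃))
      + ηm ^ 2 * quad d.R₀ y + (τM - ηm) ^ 2 * quad d.R₁ y
      + (τM - ηm) * ∑ l, quad (d.G l) ((sys.C l).toEuclideanLin y)
    ≤ ∑ j ∈ Finset.univ.erase i, (1 / (τM - ηm) * quad (d.U j) (e j)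
        - 2 * α * quad (d.Q j) (e j)) + d.b * ‖w‖ ^ 2 := by
  -- Testing with $(\xi_i, y)$, $y = \Xi_i\xi_i$, replaces the Schur complement: the off-diagonal
  -- blocks give $2y^THy$ and the corner $-y^THy$, so $+y^THy$ remains.
  have key := (h.LMI_neg i).posSemidef.dotProduct_mulVec_nonneg
    (Sum.elim (xiVec i x₀ x₁ x₂ x₃ e w) y.ofLp)
  have hX : Xi sys i *ᵥ xiVec i x₀ x₁ x₂ x₃ e w = y.ofLp := by rw [Xi_mulVec_xiVec, hy]
  have hP : (d.P)ᵀ = d.P := posSemidef_transpose_eq h.P_pos.posSemidef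
  have hc : xiVec i x₀ x₁ x₂ x₃ e w ⬝ᵥ
      (((Xi sys i)ᵀ * HMat sys ηm τM d) *ᵥ y.ofLp) = y.ofLp ⬝ᵥ (HMat sys ηm τM d *ᵥ y.ofLp) := by
    rw [← mulVec_mulVec, dotProduct_mulVec, vecMul_transpose, hX]
  have hc' : y.ofLp ⬝ᵥ (((Xi sys i)ᵀ * HMat sys ηm τM d)ᵀ *ᵥ xiVec i x₀ x₁ x₂ x₃ e w) =
      y.ofLp ⬝ᵥ (HMat sys ηm τM d *ᵥ y.ofLp) := by
    rw [dotProduct_mulVec, vecMul_transpose, dotProduct_comm, hc]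
  have h1 : xiVec i x₀ x₁ x₂ x₃ e w ⬝ᵥ
      (((F₁ n q p i)ᵀ * d.P * Xi sys i) *ᵥ xiVec i x₀ x₁ x₂ x₃ e w) = bil d.P x₀ y := by
    rw [Matrix.mul_assoc, ← mulVec_mulVec, ← mulVec_mulVec, dotProduct_mulVec, vecMul_transpose,
      hX, F₁_mulVec_xiVec, bil]
  have h2 : xiVec i x₀ x₁ x₂ x₃ e w ⬝ᵥ
      (((Xi sys i)ᵀ * d.P * F₁ n q p i) *ᵥ xiVec i x₀ x₁ x₂ x₃ e w) = bil d.P x₀ y := by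
    rw [Matrix.mul_assoc, ← mulVec_mulVec, ← mulVec_mulVec, dotProduct_mulVec, vecMul_transpose,
      hX, F₁_mulVec_xiVec, bil_comm hP, bil]
  simp only [LMIMat, SigmaMat, neg_mulVec, fromBlocks_mulVec, Sum.elim_comp_inl, Sum.elim_comp_inr,
    star_trivial, dotProduct_neg, sumElim_dotProduct_sumElim, dotProduct_add, add_mulVec,
    sub_mulVec, dotProduct_sub, smul_mulVec, dotProduct_smul, hc, hc', h1, h2, Upsilon_form,
    dotProduct_conj_mulVec, F₂_mulVec_xiVec, FMat_mulVec_xiVec, Phi_form, HMat_form,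
    smul_eq_mul] at key
  have hs : ∑ j ∈ Finset.univ.erase i, (-(1 / (τM - ηm)) * quad (d.U j) (e j)
        + 2 * α * quad (d.Q j) (e j)) = - ∑ j ∈ Finset.univ.erase i,
        (1 / (τM - ηm) * quad (d.U j) (e j) - 2 * α * quad (d.Q j) (e j)) := by
    rw [← Finset.sum_neg_distrib]
    exact Finset.sum_congr rfl fun j _ => by ring
  rw [hs] at key
  simp only [quad] at key ⊢
  linarith

/-- The first matrix inequality as an inequality between quadratic forms. -/
lemma Feasible.omega_le (h : Feasible sys ηm τM α d) (u v : EuclideanSpace ℝ (Fin (p i))) :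
    quad (d.U i) u + 2 * bil (d.Q i) u v + quad (d.Q i) v
      ≤ (1 - 2 * α * (τM - ηm)) / ((N : ℝ) - 1) * quad (d.Q i) u
        + Real.exp (-2 * α * τM) * quad (d.G i) v := by
  have key := (h.Omega_neg i).posSemidef.dotProduct_mulVec_nonneg (Sum.elim u.ofLp v.ofLp)
  have hQ : (d.Q i)ᵀ = d.Q i := posSemidef_transpose_eq (h.Q_pos i).posSemidef
  have hb := bil_comm hQ u v
  simp only [Omega, neg_mulVec, fromBlocks_mulVec, Sum.elim_comp_inl, Sum.elim_comp_inr,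
    star_trivial, dotProduct_neg, sumElim_dotProduct_sumElim, dotProduct_add, add_mulVec,
    sub_mulVec, dotProduct_sub, smul_mulVec, dotProduct_smul, smul_eq_mul, hQ] at key
  simp only [quad, bil] at *
  linarith

/-- The reciprocally convex combination inequality. -/
lemma reciprocally_convex (hΦ : (Phi d).PosSemidef) (u v : EuclideanSpace ℝ (Fin n)) {a b : ℝ}
    (ha : 0 < a) (hb : 0 < b) :
    quad d.R₁ u + 2 * bil d.S₁₂ u v + quad d.R₁ v
      ≤ (a + b) * (quad d.R₁ u / a + quad d.R₁ v / b) := by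
  -- The two scalings have product $-1$, so the cross term is exactly $-2u^TS_{12}v$, while the
  -- diagonal ones produce the excess in $(a+b)/a = 1+b/a$ and $(a+b)/b = 1+a/b$.
  have h := hΦ.dotProduct_mulVec_nonneg (Sum.elim (√(b / a) • u).ofLp (-√(a / b) • v).ofLp)
  rw [star_trivial, Phi_form, quad_smul, quad_smul, bil_smul_left, bil_smul_right, neg_sq,
    Real.sq_sqrt (by positivity), Real.sq_sqrt (by positivity)] at h
  have h1 : √(b / a) * √(a / b) = 1 := by
    rw [← Real.sqrt_mul (by positivity), div_mul_div_comm, mul_comm b a,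
      div_self (by positivity), Real.sqrt_one]
  have h2 : (a + b) * (quad d.R₁ u / a + quad d.R₁ v / b) =
      quad d.R₁ u + quad d.R₁ v + b / a * quad d.R₁ u + a / b * quad d.R₁ v := by
    field_simp
    ring
  have h3 : √(b / a) * (-√(a / b) * bil d.S₁₂ u v) = - bil d.S₁₂ u v := by
    rw [← mul_assoc, mul_neg, h1, neg_one_mul]
  rw [h3] at h
  linarith

end MatrixInequalities

/-! ### Increments of moving-window integrals. -/

section IntegralDerivatives

/-- `w` is integrable on `[a, b]` and integrates to the increment of `W`. -/
def HasIntegralDeriv (W w : ℝ → ℝ) (a b : ℝ) : Prop :=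
  IntervalIntegrable w volume a b ∧ W b - W a = ∫ s in a..b, w s

variable {W₁ W₂ w₁ w₂ g : ℝ → ℝ} {a b c d l r : ℝ}

lemma HasIntegralDeriv.add (h₁ : HasIntegralDeriv W₁ w₁ a b) (h₂ : HasIntegralDeriv W₂ w₂ a b) :
    HasIntegralDeriv (fun t => W₁ t + W₂ t) (fun t => w₁ t + w₂ t) a b := by
  refine ⟨h₁.1.add h₂.1, ?_⟩
  rw [intervalIntegral.integral_add h₁.1 h₂.1, ← h₁.2, ← h₂.2]
  ring

lemma HasIntegralDeriv.sub (h₁ : HasIntegralDeriv W₁ w₁ a b) (h₂ : HasIntegralDeriv W₂ w₂ a b) :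
    HasIntegralDeriv (fun t => W₁ t - W₂ t) (fun t => w₁ t - w₂ t) a b := by
  refine ⟨h₁.1.sub h₂.1, ?_⟩
  rw [intervalIntegral.integral_sub h₁.1 h₂.1, ← h₁.2, ← h₂.2]
  ring

lemma HasIntegralDeriv.const_mul (k : ℝ) (h : HasIntegralDeriv W₁ w₁ a b) :
    HasIntegralDeriv (fun t => k * W₁ t) (fun t => k * w₁ t) a b := by
  refine ⟨h.1.const_mul k, ?_⟩
  rw [intervalIntegral.integral_const_mul, ← h.2]
  ring

lemma HasIntegralDeriv.sum {ι : Type*} {s : Finset ι} {W w : ι → ℝ → ℝ}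
    (h : ∀ i ∈ s, HasIntegralDeriv (W i) (w i) a b) :
    HasIntegralDeriv (fun t => ∑ i ∈ s, W i t) (fun t => ∑ i ∈ s, w i t) a b := by
  have h1 := IntervalIntegrable.sum s (fun i hi => (h i hi).1)
  refine ⟨by simpa [Finset.sum_fn] using h1, ?_⟩
  rw [intervalIntegral.integral_finsetSum (fun i hi => (h i hi).1), ← Finset.sum_sub_distrib]
  exact Finset.sum_congr rfl fun i hi => (h i hi).2

lemma HasIntegralDeriv.congr (h : HasIntegralDeriv W₁ w₁ a b)
    (hab : a ≤ b) (hW : ∀ t ∈ Set.Icc a b, W₂ t = W₁ t)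
    (hw : ∀ t ∈ Set.Icc a b, w₂ t = w₁ t) : HasIntegralDeriv W₂ w₂ a b := by
  have h1 : Set.EqOn w₁ w₂ (Set.uIcc a b) := fun t ht => by
    rw [Set.uIcc_of_le hab] at ht
    exact (hw t ht).symm
  refine ⟨h.1.congr (h1.mono Set.uIoc_subset_uIcc), ?_⟩
  rw [hW b ⟨hab, le_rfl⟩, hW a ⟨le_rfl, hab⟩, h.2, intervalIntegral.integral_congr h1]

lemma intervalIntegrable_of_subinterval (hg : IntervalIntegrable g volume l r)
    (hla : l ≤ a) (hab : a ≤ b) (hbr : b ≤ r) : IntervalIntegrable g volume a b := by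
  apply hg.mono_set
  rw [Set.uIcc_of_le hab, Set.uIcc_of_le (by linarith)]
  exact Set.Icc_subset_Icc hla hbr

lemma hasIntegralDeriv_primitive (k : ℝ) (hk : IntervalIntegrable g volume k a)
    (hg : IntervalIntegrable g volume a b) :
    HasIntegralDeriv (fun t => ∫ s in k..t, g s) g a b := by
  refine ⟨hg, ?_⟩
  simp only
  rw [← intervalIntegral.integral_add_adjacent_intervals hk hg]
  ring

lemma hasIntegralDeriv_window (hg : IntervalIntegrable g volume l r) (hab : a ≤ b)
    (hdc : d ≤ c) (hl : l ≤ a - c) (hr : b - d ≤ r) :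
    HasIntegralDeriv (fun t => ∫ s in (t - c)..(t - d), g s) (fun t => g (t - d) - g (t - c))
      a b := by
  have hi : ∀ {u v : ℝ}, l ≤ u → u ≤ v → v ≤ r → IntervalIntegrable g volume u v :=
    fun h1 h2 h3 => intervalIntegrable_of_subinterval hg h1 h2 h3
  have h1 : IntervalIntegrable (fun t => g (t - d)) volume a b := by
    simpa using (hi (u := a - d) (v := b - d) (by linarith) (by linarith) hr).comp_sub_right d
  have h2 : IntervalIntegrable (fun t => g (t - c)) volume a b := by
    simpa using (hi (u := a - c) (v := b - c) hl (by linarith) (by linarith)).comp_sub_right c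
  refine ⟨h1.sub h2, ?_⟩
  rw [intervalIntegral.integral_sub h1 h2, intervalIntegral.integral_comp_sub_right,
    intervalIntegral.integral_comp_sub_right]
  have e1 := intervalIntegral.integral_add_adjacent_intervals
    (hi (u := a - c) (v := b - c) hl (by linarith) (by linarith))
    (hi (u := b - c) (v := b - d) (by linarith) (by linarith) hr)
  have e2 := intervalIntegral.integral_add_adjacent_intervals
    (hi (u := a - c) (v := a - d) hl (by linarith) (by linarith))
    (hi (u := a - d) (v := b - d) (by linarith) (by linarith) hr)
  linarith

/-- With a primitive $\Gamma$ of $g$, the inner integral is $\Gamma(t)-\Gamma(t+\theta)$. The double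
integral is therefore $(c-d)\Gamma(t)$ minus a moving-window integral of $\Gamma$, and
`hasIntegralDeriv_window` applies to the latter. -/
lemma hasIntegralDeriv_double (hg : IntervalIntegrable g volume l r) (hab : a ≤ b)
    (hd : 0 ≤ d) (hdc : d ≤ c) (hl : l ≤ a - c) (hr : b ≤ r) :
    HasIntegralDeriv (fun t => ∫ θ in (-c)..(-d), ∫ s in (t + θ)..t, g s)
      (fun t => (c - d) * g t - ∫ s in (t - c)..(t - d), g s) a b := by
  have hi : ∀ {u v : ℝ}, l ≤ u → u ≤ v → v ≤ r → IntervalIntegrable g volume u v :=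
    fun h1 h2 h3 => intervalIntegrable_of_subinterval hg h1 h2 h3
  set Γ : ℝ → ℝ := fun u => ∫ s in l..u, g s with hΓ
  have hΓc : ContinuousOn Γ (Set.uIcc l r) :=
    intervalIntegral.continuousOn_primitive_interval' hg Set.left_mem_uIcc
  have hΓi : IntervalIntegrable Γ volume l r := hΓc.intervalIntegrable
  have hsub : ∀ {u v : ℝ}, l ≤ u → u ≤ v → v ≤ r → ∫ s in u..v, g s = Γ v - Γ u := by
    intro u v h1 h2 h3
    have := intervalIntegral.integral_add_adjacent_intervals
      (hi (u := l) (v := u) le_rfl h1 (by linarith)) (hi (u := u) (v := v) h1 h2 h3)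
    simp only [hΓ]
    linarith
  have h1 : HasIntegralDeriv Γ g a b :=
    hasIntegralDeriv_primitive l (hi le_rfl (by linarith) (by linarith)) (hi (by linarith) hab hr)
  have h2 := hasIntegralDeriv_window hΓi hab hdc hl (by linarith)
  refine ((h1.const_mul (c - d)).sub h2).congr hab ?_ ?_
  · intro t ht
    have h3 : ∀ θ ∈ Set.uIcc (-c) (-d), ∫ s in (t + θ)..t, g s = Γ t - Γ (t + θ) := by
      intro θ hθ
      rw [Set.uIcc_of_le (by linarith)] at hθ
      exact hsub (by linarith [hθ.1, ht.1]) (by linarith [hθ.2]) (by linarith [ht.2])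
    rw [intervalIntegral.integral_congr h3]
    have h4 : IntervalIntegrable (fun θ => Γ (t + θ)) volume (-c) (-d) := by
      have h5 : IntervalIntegrable Γ volume (t - c) (t - d) :=
        intervalIntegrable_of_subinterval hΓi (by linarith [ht.1]) (by linarith)
          (by linarith [ht.2])
      have h6 := h5.comp_add_left t
      convert h6 using 1 <;> ring
    rw [intervalIntegral.integral_sub intervalIntegrable_const h4,
      intervalIntegral.integral_comp_add_left, intervalIntegral.integral_const]
    simp only [smul_eq_mul, ← sub_eq_add_neg]
    ring
  · intro t ht
    rw [hsub (by linarith [ht.1]) (by linarith) (by linarith [ht.2])]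

end IntegralDerivatives

/-! ### Absolutely continuous curves, the chain rule and Jensen's inequality. -/

section AbsoluteContinuity

variable {E : Type*} [NormedAddCommGroup E] {a b : ℝ}

lemma lipschitzOnWith_comp_absolutelyContinuous {F : Type*} [PseudoMetricSpace F]
    {x : ℝ → E} (hx : AbsolutelyContinuousOnInterval x a b) {g : E → F} {K : NNReal} {s : Set E}
    (hg : LipschitzOnWith K g s) (hs : Set.MapsTo x (Set.uIcc a b) s) :
    AbsolutelyContinuousOnInterval (fun t => g (x t)) a b := by
  have h0 : Filter.Tendsto (fun E : ℕ × (ℕ → ℝ × ℝ) =>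
      (K : ℝ) * ∑ i ∈ Finset.range E.1, dist (x (E.2 i).1) (x (E.2 i).2))
      (AbsolutelyContinuousOnInterval.totalLengthFilter ⊓
        Filter.principal (AbsolutelyContinuousOnInterval.disjWithin a b)) (nhds 0) := by
    simpa using Filter.Tendsto.const_mul (K : ℝ) hx
  refine squeeze_zero' (Filter.Eventually.of_forall fun E => ?_) ?_ h0
  · exact Finset.sum_nonneg fun i _ => dist_nonneg
  · refine Filter.eventually_inf_principal.2 (Filter.Eventually.of_forall fun E hE => ?_)
    rw [Finset.mul_sum]
    refine Finset.sum_le_sum fun i hi => ?_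
    exact hg.dist_le_mul _ (hs (hE.1 i hi).1) _ (hs (hE.1 i hi).2)

/-- An absolutely continuous curve on a compact interval stays in a closed ball, and a $C^1$ map is
Lipschitz there. -/
lemma contDiff_comp_absolutelyContinuous [NormedSpace ℝ E] [ProperSpace E] {F : Type*}
    [NormedAddCommGroup F] [NormedSpace ℝ F]
    {x : ℝ → E} (hx : AbsolutelyContinuousOnInterval x a b) {g : E → F} (hg : ContDiff ℝ 1 g) :
    AbsolutelyContinuousOnInterval (fun t => g (x t)) a b := by
  obtain ⟨C, hC⟩ := hx.exists_bound
  obtain ⟨K, hK⟩ := hg.contDiffOn.exists_lipschitzOnWith (s := Metric.closedBall (0 : E) C)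
    (by decide) (convex_closedBall _ _) (isCompact_closedBall _ _)
  exact lipschitzOnWith_comp_absolutelyContinuous hx hK fun t ht => by simpa using hC t ht

variable {n : ℕ} {x : ℝ → EuclideanSpace ℝ (Fin n)} {M : Matrix (Fin n) (Fin n) ℝ}

lemma ae_differentiableAt_of_absolutelyContinuous (hx : AbsolutelyContinuousOnInterval x a b) :
    ∀ᵐ t : ℝ, t ∈ Set.uIcc a b → DifferentiableAt ℝ x t := by
  have h : ∀ i : Fin n, ∀ᵐ t : ℝ, t ∈ Set.uIcc a b → DifferentiableAt ℝ (fun t => x t i) t :=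
    fun i => (contDiff_comp_absolutelyContinuous hx
      (EuclideanSpace.proj (𝕜 := ℝ) i).contDiff).ae_differentiableAt
  filter_upwards [ae_all_iff.2 h] with t ht hab
  exact differentiableAt_euclidean.2 fun i => ht i hab

lemma quad_eq_inner (v : EuclideanSpace ℝ (Fin n)) :
    quad M v = inner ℝ (M.toEuclideanLin.toContinuousLinearMap v) v := by
  simp [quad, EuclideanSpace.inner_eq_star_dotProduct]

lemma bil_eq_inner (u v : EuclideanSpace ℝ (Fin n)) :
    bil M u v = inner ℝ (M.toEuclideanLin.toContinuousLinearMap v) u := by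
  simp [bil, EuclideanSpace.inner_eq_star_dotProduct]

lemma contDiff_quad : ContDiff ℝ 1 (quad M) := by
  have : quad M = fun v => inner ℝ (M.toEuclideanLin.toContinuousLinearMap v) v :=
    funext quad_eq_inner
  rw [this]
  exact (ContinuousLinearMap.contDiff _).inner ℝ contDiff_id

lemma contDiff_bil (u : EuclideanSpace ℝ (Fin n)) : ContDiff ℝ 1 (bil M u) := by
  have : bil M u = fun v => inner ℝ (M.toEuclideanLin.toContinuousLinearMap v) u :=
    funext (bil_eq_inner u)
  rw [this]
  exact (ContinuousLinearMap.contDiff _).inner ℝ contDiff_const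

lemma hasDerivAt_quad (hM : Mᵀ = M) {t : ℝ} {x' : EuclideanSpace ℝ (Fin n)}
    (hx : HasDerivAt x x' t) : HasDerivAt (fun s => quad M (x s)) (2 * bil M (x t) x') t := by
  have h := ((M.toEuclideanLin.toContinuousLinearMap.hasFDerivAt (x := x t)).comp_hasDerivAt t
    hx).inner ℝ hx
  simp only [quad_eq_inner]
  refine h.congr_deriv ?_
  simp only [Function.comp_apply]
  rw [← bil_eq_inner, ← bil_eq_inner, bil_comm hM]
  ring

lemma hasDerivAt_bil (u : EuclideanSpace ℝ (Fin n)) {t : ℝ} {x' : EuclideanSpace ℝ (Fin n)}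
    (hx : HasDerivAt x x' t) : HasDerivAt (fun s => bil M u (x s)) (bil M u x') t := by
  have h := ((M.toEuclideanLin.toContinuousLinearMap.hasFDerivAt (x := x t)).comp_hasDerivAt t
    hx).inner ℝ (hasDerivAt_const t u)
  simp only [bil_eq_inner]
  refine h.congr_deriv ?_
  simp

/-- The fundamental theorem of calculus for absolutely continuous functions, with an explicit
almost everywhere derivative. -/
lemma hasIntegralDeriv_of_absolutelyContinuous {W w : ℝ → ℝ}
    (hW : AbsolutelyContinuousOnInterval W a b)
    (hw : ∀ᵐ t : ℝ, t ∈ Set.uIcc a b → HasDerivAt W (w t) t) : HasIntegralDeriv W w a b := by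
  have h : ∀ᵐ t : ℝ, t ∈ Set.uIoc a b → deriv W t = w t := by
    filter_upwards [hw] with t ht hab
    exact (ht (Set.uIoc_subset_uIcc hab)).deriv
  refine ⟨hW.intervalIntegrable_deriv.congr_ae ((ae_restrict_iff' measurableSet_uIoc).2 h), ?_⟩
  rw [← hW.integral_deriv_eq_sub, intervalIntegral.integral_congr_ae h]

lemma hasIntegralDeriv_bil (hx : AbsolutelyContinuousOnInterval x a b)
    (u : EuclideanSpace ℝ (Fin n)) :
    HasIntegralDeriv (fun s => bil M u (x s)) (fun s => bil M u (deriv x s)) a b := by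
  refine hasIntegralDeriv_of_absolutelyContinuous
    (contDiff_comp_absolutelyContinuous hx (contDiff_bil u)) ?_
  filter_upwards [ae_differentiableAt_of_absolutelyContinuous hx] with t ht hab
  exact hasDerivAt_bil u (ht hab).hasDerivAt

lemma hasIntegralDeriv_exp_mul_quad (hM : Mᵀ = M) (α : ℝ)
    (hx : AbsolutelyContinuousOnInterval x a b) :
    HasIntegralDeriv (fun s => Real.exp (2 * α * s) * quad M (x s))
      (fun s => Real.exp (2 * α * s) * (2 * α * quad M (x s) + 2 * bil M (x s) (deriv x s)))
      a b := by
  have hexp : ContDiff ℝ 1 (fun s : ℝ => Real.exp (2 * α * s)) := by fun_prop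
  refine hasIntegralDeriv_of_absolutelyContinuous
    (hexp.contDiffOn.absolutelyContinuousOnInterval.fun_mul
      (contDiff_comp_absolutelyContinuous hx contDiff_quad)) ?_
  filter_upwards [ae_differentiableAt_of_absolutelyContinuous hx] with t ht hab
  have h1 : HasDerivAt (fun s : ℝ => Real.exp (2 * α * s)) (Real.exp (2 * α * t) * (2 * α)) t := by
    simpa using ((hasDerivAt_id t).const_mul (2 * α)).exp
  exact (h1.mul (hasDerivAt_quad hM (ht hab).hasDerivAt)).congr_deriv (by ring)

lemma intervalIntegrable_quad_deriv (hx : IntervalIntegrable (fun s => ‖deriv x s‖ ^ 2) volume a b) :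
    IntervalIntegrable (fun s => quad M (deriv x s)) volume a b := by
  obtain ⟨c, -, hc⟩ := exists_quad_le M
  refine (hx.const_mul c).mono_fun ?_ ?_
  · exact (continuous_quad.measurable.comp (measurable_deriv x)).aestronglyMeasurable
  · refine Filter.Eventually.of_forall fun s => ?_
    change |_| ≤ |_|
    exact (hc _).trans (le_abs_self _)

/-- Jensen's inequality for quadratic forms of the derivative. -/
lemma quad_sub_le_integral (hM : M.PosSemidef) (hab : a ≤ b)
    (hx : AbsolutelyContinuousOnInterval x a b)
    (hx2 : IntervalIntegrable (fun s => ‖deriv x s‖ ^ 2) volume a b) :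
    quad M (x b - x a) ≤ (b - a) * ∫ s in a..b, quad M (deriv x s) := by
  rcases hab.eq_or_lt with rfl | hab'
  · simp
  have hT := posSemidef_transpose_eq hM
  have hpos : 0 < b - a := sub_pos.2 hab'
  -- The mean of $\dot x$. Integrating $0 \le (\dot x-v)^TM(\dot x-v)$ in the form $2v^TM\dot x -
  -- v^TMv \le \dot x^TM\dot x$ gives Jensen's inequality.
  set v := (b - a)⁻¹ • (x b - x a) with hv
  have hb := hasIntegralDeriv_bil (M := M) hx v
  have hle : ∫ s in a..b, (2 * bil M v (deriv x s) - quad M v) ≤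
      ∫ s in a..b, quad M (deriv x s) := by
    refine intervalIntegral.integral_mono_on hab ((hb.1.const_mul 2).sub intervalIntegrable_const)
      (intervalIntegrable_quad_deriv hx2) fun s _ => ?_
    have h := quad_nonneg hM (deriv x s - v)
    rw [quad_sub hT, bil_comm hT] at h
    linarith
  rw [intervalIntegral.integral_sub (hb.1.const_mul 2) intervalIntegrable_const,
    intervalIntegral.integral_const_mul, ← hb.2, intervalIntegral.integral_const] at hle
  have h1 : bil M v (x b) - bil M v (x a) = (b - a)⁻¹ * quad M (x b - x a) := by
    rw [hv, bil_smul_left, bil_smul_left, ← mul_sub]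
    congr 1
    simp [bil, quad, mulVec_sub]
  have h2 : quad M v = (b - a)⁻¹ ^ 2 * quad M (x b - x a) := by rw [hv, quad_smul]
  rw [h1, h2, smul_eq_mul] at hle
  have h3 : 2 * ((b - a)⁻¹ * quad M (x b - x a)) -
      (b - a) * ((b - a)⁻¹ ^ 2 * quad M (x b - x a)) = quad M (x b - x a) / (b - a) := by
    field_simp
    ring
  rw [h3, div_le_iff₀ hpos] at hle
  linarith

/-- Jensen's inequality with an exponential weight. -/
lemma exp_mul_quad_sub_le_integral {α c t : ℝ} (hα : 0 ≤ α) (hM : M.PosSemidef) (hab : a ≤ b)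
    (hx : AbsolutelyContinuousOnInterval x a b)
    (hx2 : IntervalIntegrable (fun s => ‖deriv x s‖ ^ 2) volume a b) (hc : t - c ≤ a) :
    Real.exp (2 * α * (t - c)) * quad M (x b - x a)
      ≤ (b - a) * ∫ s in a..b, Real.exp (2 * α * s) * quad M (deriv x s) := by
  have hq := intervalIntegrable_quad_deriv (M := M) hx2
  have h1 := mul_le_mul_of_nonneg_left (quad_sub_le_integral hM hab hx hx2)
    (Real.exp_pos (2 * α * (t - c))).le
  refine h1.trans ?_
  rw [mul_left_comm, ← intervalIntegral.integral_const_mul]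
  refine mul_le_mul_of_nonneg_left ?_ (sub_nonneg.2 hab)
  refine intervalIntegral.integral_mono_on hab (hq.const_mul _)
    (hq.continuousOn_mul (by fun_prop)) fun s hs => ?_
  refine mul_le_mul_of_nonneg_right (Real.exp_le_exp.2 ?_) (quad_nonneg hM _)
  nlinarith [hs.1]

end AbsoluteContinuity

/-! ### The functional between two updates. -/

section Flow

variable {N n q : ℕ} {p : Fin N → ℕ} {sys : Plant n q p} {ηm τM α : ℝ} {d : DecisionVars n p}

lemma exp_mul_weighted_integral (f : ℝ → ℝ) (a b t : ℝ) :
    Real.exp (2 * α * t) * ∫ s in a..b, Real.exp (2 * α * (s - t)) * f s =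
      ∫ s in a..b, Real.exp (2 * α * s) * f s := by
  rw [← intervalIntegral.integral_const_mul]
  congr 1
  ext s
  rw [← mul_assoc, ← Real.exp_add]
  ring_nf

lemma exp_mul_weighted_double_integral (f : ℝ → ℝ) (a b t : ℝ) :
    Real.exp (2 * α * t) * ∫ θ in a..b, ∫ s in (t + θ)..t, Real.exp (2 * α * (s - t)) * f s =
      ∫ θ in a..b, ∫ s in (t + θ)..t, Real.exp (2 * α * s) * f s := by
  rw [← intervalIntegral.integral_const_mul]
  simp only [exp_mul_weighted_integral]

/-- The factor turns the weights $e^{2\alpha(s-t)}$ into $e^{2\alpha s}$, so that $t$ enters the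
integrals only through their limits. The zeros in `t - 0` and `-0` fit the window lemmas with $d=0$.
-/
lemma exp_mul_V (x : ℝ → EuclideanSpace ℝ (Fin n)) (sk t : ℝ) :
    Real.exp (2 * α * t) * V sys ηm τM α d x sk t =
      Real.exp (2 * α * t) * quad d.P (x t)
      + (∫ s in (t - ηm)..(t - 0), Real.exp (2 * α * s) * quad d.S₀ (x s))
      + (∫ s in (t - τM)..(t - ηm), Real.exp (2 * α * s) * quad d.S₁ (x s))
      + ηm * (∫ θ in (-ηm)..(-0), ∫ s in (t + θ)..t,
          Real.exp (2 * α * s) * quad d.R₀ (deriv x s))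
      + (τM - ηm) * (∫ θ in (-τM)..(-ηm), ∫ s in (t + θ)..t,
          Real.exp (2 * α * s) * quad d.R₁ (deriv x s))
      + ∑ i, (τM - ηm) * ∫ s in sk..t,
          Real.exp (2 * α * s) * quad ((sys.C i)ᵀ * d.G i * sys.C i) (deriv x s) := by
  simp only [V, VTilde, VG, mul_add, Finset.mul_sum, mul_left_comm (Real.exp (2 * α * t)) ηm,
    mul_left_comm (Real.exp (2 * α * t)) (τM - ηm), exp_mul_weighted_integral,
    exp_mul_weighted_double_integral, sub_zero, neg_zero, quad_conj]

lemma posSemidef_conj (h : Feasible sys ηm τM α d) (i : Fin N) :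
    ((sys.C i)ᵀ * d.G i * sys.C i).PosSemidef := by
  have := (h.G_pos i).posSemidef.conjTranspose_mul_mul_same (sys.C i)
  rwa [conjTranspose_eq_transpose_of_trivial] at this

variable {x : ℝ → EuclideanSpace ℝ (Fin n)} {l sk a t : ℝ}

/-- The growth rate of `exp (2αt) V(t)`. -/
noncomputable def growthRate (sys : Plant n q p) (ηm τM α : ℝ) (d : DecisionVars n p)
    (x : ℝ → EuclideanSpace ℝ (Fin n)) (s : ℝ) : ℝ :=
  Real.exp (2 * α * s) * (2 * α * quad d.P (x s) + 2 * bil d.P (x s) (deriv x s))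
  + (Real.exp (2 * α * (s - 0)) * quad d.S₀ (x (s - 0))
      - Real.exp (2 * α * (s - ηm)) * quad d.S₀ (x (s - ηm)))
  + (Real.exp (2 * α * (s - ηm)) * quad d.S₁ (x (s - ηm))
      - Real.exp (2 * α * (s - τM)) * quad d.S₁ (x (s - τM)))
  + ηm * ((ηm - 0) * (Real.exp (2 * α * s) * quad d.R₀ (deriv x s))
      - ∫ r in (s - ηm)..(s - 0), Real.exp (2 * α * r) * quad d.R₀ (deriv x r))
  + (τM - ηm) * ((τM - ηm) * (Real.exp (2 * α * s) * quad d.R₁ (deriv x s))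
      - ∫ r in (s - τM)..(s - ηm), Real.exp (2 * α * r) * quad d.R₁ (deriv x r))
  + ∑ i, (τM - ηm) * (Real.exp (2 * α * s)
      * quad ((sys.C i)ᵀ * d.G i * sys.C i) (deriv x s))

lemma hasIntegralDeriv_exp_mul_V (h : Feasible sys ηm τM α d) (hη : 0 ≤ ηm) (hτ : ηm < τM)
    (hx : AbsolutelyContinuousOnInterval x l t)
    (hx2 : IntervalIntegrable (fun s => ‖deriv x s‖ ^ 2) volume l t)
    (hl : l ≤ a - τM) (hat : a ≤ t) (hlsk : l ≤ sk) (hska : sk ≤ a) :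
    HasIntegralDeriv (fun s => Real.exp (2 * α * s) * V sys ηm τM α d x sk s)
      (growthRate sys ηm τM α d x) a t := by
  have hlt : l ≤ t := by linarith
  have hc : ∀ M : Matrix (Fin n) (Fin n) ℝ,
      IntervalIntegrable (fun s => Real.exp (2 * α * s) * quad M (x s)) volume l t := fun M => by
    apply ContinuousOn.intervalIntegrable
    exact (by fun_prop : Continuous fun s : ℝ => Real.exp (2 * α * s)).continuousOn.mul
      (continuous_quad.comp_continuousOn hx.continuousOn)
  have hq : ∀ M : Matrix (Fin n) (Fin n) ℝ,
      IntervalIntegrable (fun s => Real.exp (2 * α * s) * quad M (deriv x s)) volume l t :=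
    fun M => (intervalIntegrable_quad_deriv hx2).continuousOn_mul (by fun_prop)
  have hxa : AbsolutelyContinuousOnInterval x a t := by
    apply hx.mono
    rw [Set.uIcc_of_le hat, Set.uIcc_of_le hlt]
    exact Set.Icc_subset_Icc (by linarith) le_rfl
  have h1 := hasIntegralDeriv_exp_mul_quad (posSemidef_transpose_eq h.P_pos.posSemidef) α hxa
  have h2 := hasIntegralDeriv_window (hc d.S₀) hat hη (by linarith) (by linarith)
  have h3 := hasIntegralDeriv_window (hc d.S₁) hat hτ.le hl (by linarith)
  have h4 := hasIntegralDeriv_double (hq d.R₀) hat le_rfl hη (by linarith) le_rfl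
  have h5 := hasIntegralDeriv_double (hq d.R₁) hat hη hτ.le hl le_rfl
  have h6 := HasIntegralDeriv.sum (s := Finset.univ) fun i _ => (hasIntegralDeriv_primitive sk
    (intervalIntegrable_of_subinterval (hq ((sys.C i)ᵀ * d.G i * sys.C i)) hlsk hska hat)
    (intervalIntegrable_of_subinterval (hq ((sys.C i)ᵀ * d.G i * sys.C i)) (by linarith) hat
      le_rfl)).const_mul (τM - ηm)
  exact (((((h1.add h2).add h3).add (h4.const_mul ηm)).add (h5.const_mul (τM - ηm))).add h6).congr
    hat (fun s _ => exp_mul_V x sk s) (fun s _ => rfl)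

/-- Here $v$ will be the sampling instant, which cuts the window $[u,w]$ in two. Jensen's inequality
on each piece leaves the reciprocals of the two lengths, which the reciprocally convex combination
removes. -/
lemma mul_integral_ge_reciprocal (h : Feasible sys ηm τM α d) (hα : 0 ≤ α)
    {u v w : ℝ} (huv : u ≤ v) (hvw : v ≤ w) (huw : w - u = τM - ηm) (hτ : ηm < τM)
    (hx : AbsolutelyContinuousOnInterval x u w)
    (hx2 : IntervalIntegrable (fun s => ‖deriv x s‖ ^ 2) volume u w) :
    Real.exp (2 * α * u) * (quad d.R₁ (x w - x v) + 2 * bil d.S₁₂ (x w - x v) (x v - x u)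
        + quad d.R₁ (x v - x u))
      ≤ (τM - ηm) * ∫ r in u..w, Real.exp (2 * α * r) * quad d.R₁ (deriv x r) := by
  have hR := h.R₁_pos.posSemidef
  have hsub : ∀ {y z : ℝ}, u ≤ y → y ≤ z → z ≤ w → AbsolutelyContinuousOnInterval x y z ∧
      IntervalIntegrable (fun s => ‖deriv x s‖ ^ 2) volume y z := by
    intro y z h1 h2 h3
    refine ⟨hx.mono ?_, intervalIntegrable_of_subinterval hx2 h1 h2 h3⟩
    rw [Set.uIcc_of_le h2, Set.uIcc_of_le (by linarith)]
    exact Set.Icc_subset_Icc h1 h3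
  have hI : ∀ {y z : ℝ}, u ≤ y → y ≤ z → z ≤ w → Real.exp (2 * α * u) * quad d.R₁ (x z - x y)
      ≤ (z - y) * ∫ r in y..z, Real.exp (2 * α * r) * quad d.R₁ (deriv x r) := by
    intro y z h1 h2 h3
    simpa using exp_mul_quad_sub_le_integral (t := u) (c := 0) hα hR h2 (hsub h1 h2 h3).1
      (hsub h1 h2 h3).2 (by simpa using h1)
  -- If $v$ is an end point, one of the differences vanishes and Jensen's inequality on the whole
  -- window suffices.
  rcases huv.eq_or_lt with rfl | huv'
  · have := hI le_rfl hvw le_rfl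
    rw [huw] at this
    simpa [bil] using this
  rcases hvw.eq_or_lt with rfl | hvw'
  · have := hI le_rfl huv le_rfl
    rw [huw] at this
    simpa [bil] using this
  have hi : ∀ {y z : ℝ}, u ≤ y → y ≤ z → z ≤ w →
      IntervalIntegrable (fun r => Real.exp (2 * α * r) * quad d.R₁ (deriv x r)) volume y z :=
    fun h1 h2 h3 => (intervalIntegrable_quad_deriv (hsub h1 h2 h3).2).continuousOn_mul
      (by fun_prop)
  rw [← intervalIntegral.integral_add_adjacent_intervals (hi le_rfl huv hvw) (hi huv hvw le_rfl)]
  have ha : 0 < w - v := by linarith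
  have hb : 0 < v - u := by linarith
  have hrc := mul_le_mul_of_nonneg_left
    (reciprocally_convex h.Phi_nonneg (x w - x v) (x v - x u) ha hb) (Real.exp_pos (2 * α * u)).le
  refine hrc.trans ?_
  have h1 := hI le_rfl huv hvw
  have h2 := hI huv hvw le_rfl
  rw [← div_le_iff₀' hb] at h1
  rw [← div_le_iff₀' ha] at h2
  have hE : Real.exp (2 * α * u) * ((w - v + (v - u)) * (quad d.R₁ (x w - x v) / (w - v)
      + quad d.R₁ (x v - x u) / (v - u))) = (τM - ηm) *
      (Real.exp (2 * α * u) * quad d.R₁ (x v - x u) / (v - u) +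
        Real.exp (2 * α * u) * quad d.R₁ (x w - x v) / (w - v)) := by
    rw [← huw]
    ring
  rw [hE]
  exact mul_le_mul_of_nonneg_left (add_le_add h1 h2) (by linarith)

variable {i : Fin N} {e : (j : Fin N) → EuclideanSpace ℝ (Fin (p j))}

/-- The integrals in the rate enter with a minus sign. Jensen's inequality bounds the one with
$R_0$, `mul_integral_ge_reciprocal` the one with $R_1$, and what remains is the left-hand side of
`Feasible.form_le` with $x(s_k)$ as the delayed state $x(t-\tau(t))$. -/
lemma growthRate_le (h : Feasible sys ηm τM α d) (hα : 0 ≤ α) (hη : 0 ≤ ηm) (hτ : ηm < τM)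
    {s : ℝ} (hx : AbsolutelyContinuousOnInterval x (s - τM) s)
    (hx2 : IntervalIntegrable (fun s => ‖deriv x s‖ ^ 2) volume (s - τM) s)
    (hsk : s - τM ≤ sk) (hsk' : sk ≤ s - ηm) {w : EuclideanSpace ℝ (Fin q)}
    (hd : HasDerivAt x (sys.A.toEuclideanLin (x s) + sys.A₁.toEuclideanLin (x sk)
      + ∑ j ∈ Finset.univ.erase i, (sys.B j).toEuclideanLin (e j)
      + sys.D.toEuclideanLin w) s) :
    growthRate sys ηm τM α d x s ≤ Real.exp (2 * α * s) *
      (∑ j ∈ Finset.univ.erase i, (1 / (τM - ηm) * quad (d.U j) (e j)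
        - 2 * α * quad (d.Q j) (e j)) + d.b * ‖w‖ ^ 2) := by
  have hsub : ∀ {y z : ℝ}, s - τM ≤ y → y ≤ z → z ≤ s → AbsolutelyContinuousOnInterval x y z ∧
      IntervalIntegrable (fun s => ‖deriv x s‖ ^ 2) volume y z := by
    intro y z h1 h2 h3
    refine ⟨hx.mono ?_, intervalIntegrable_of_subinterval hx2 h1 h2 h3⟩
    rw [Set.uIcc_of_le h2, Set.uIcc_of_le (by linarith)]
    exact Set.Icc_subset_Icc h1 h3
  have hform := h.form_le i (x s) (x (s - ηm)) (x sk) (x (s - τM)) e w (deriv x s) hd.deriv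
  have h0 := hsub (y := s - ηm) (z := s) (by linarith) (by linarith) le_rfl
  have h1 := hsub (y := s - τM) (z := s - ηm) le_rfl (by linarith) (by linarith)
  have hJ0 := exp_mul_quad_sub_le_integral (t := s) (c := ηm) hα h.R₀_pos.posSemidef
    (by linarith) h0.1 h0.2 le_rfl
  have hJ1 := mul_integral_ge_reciprocal h hα hsk hsk' (by ring) hτ h1.1 h1.2
  have e1 : Real.exp (2 * α * (s - ηm)) = Real.exp (2 * α * s) * Real.exp (-2 * α * ηm) := by
    rw [← Real.exp_add]; ring_nf
  have e2 : Real.exp (2 * α * (s - τM)) = Real.exp (2 * α * s) * Real.exp (-2 * α * τM) := by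
    rw [← Real.exp_add]; ring_nf
  refine le_trans ?_ (mul_le_mul_of_nonneg_left hform (Real.exp_pos (2 * α * s)).le)
  have hS : ∑ i, (τM - ηm) * (Real.exp (2 * α * s)
      * quad ((sys.C i)ᵀ * d.G i * sys.C i) (deriv x s)) = Real.exp (2 * α * s) *
      ((τM - ηm) * ∑ l, quad (d.G l) ((sys.C l).toEuclideanLin (deriv x s))) := by
    simp only [quad_conj, Finset.mul_sum]
    exact Finset.sum_congr rfl fun _ _ => by ring
  rw [sub_sub_cancel] at hJ0
  rw [growthRate, hS]
  rw [e2] at hJ1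
  rw [e1] at hJ0
  simp only [sub_zero, e1, e2]
  linarith

/-- Integration of the differential inequality for `V` along the flow. -/
lemma V_le_of_flow (h : Feasible sys ηm τM α d) (hα : 0 < α) (hη : 0 ≤ ηm) (hτ : ηm < τM)
    (hx : AbsolutelyContinuousOnInterval x l t)
    (hx2 : IntervalIntegrable (fun s => ‖deriv x s‖ ^ 2) volume l t)
    (hl : l ≤ a - τM) (hat : a ≤ t) (hsk : t - τM ≤ sk) (hsk' : sk ≤ a - ηm)
    {ω : ℝ → EuclideanSpace ℝ (Fin q)} {Δ : ℝ}
    (hflow : ∀ᵐ s : ℝ, s ∈ Set.Ico a t →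
      HasDerivAt x (sys.A.toEuclideanLin (x s) + sys.A₁.toEuclideanLin (x sk)
      + ∑ j ∈ Finset.univ.erase i, (sys.B j).toEuclideanLin (e j)
      + sys.D.toEuclideanLin (ω s)) s)
    (hω : ∀ᵐ s : ℝ, s ∈ Set.Ico a t → ‖ω s‖ ≤ Δ) :
    V sys ηm τM α d x sk t ≤ Real.exp (-2 * α * (t - a)) * V sys ηm τM α d x sk a
      + (∑ j ∈ Finset.univ.erase i, (1 / (τM - ηm) * quad (d.U j) (e j)
        - 2 * α * quad (d.Q j) (e j)) + d.b * Δ ^ 2)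
        * ((1 - Real.exp (-2 * α * (t - a))) / (2 * α)) := by
  set κ := ∑ j ∈ Finset.univ.erase i, (1 / (τM - ηm) * quad (d.U j) (e j)
        - 2 * α * quad (d.Q j) (e j)) with hκ
  have hI := hasIntegralDeriv_exp_mul_V (sk := sk) h hη hτ hx hx2 hl hat (by linarith)
    (by linarith)
  have hexp : Continuous fun s : ℝ => Real.exp (2 * α * s) := by fun_prop
  have hE : ∫ s in a..t, Real.exp (2 * α * s) * (κ + d.b * Δ ^ 2) =
      (Real.exp (2 * α * t) - Real.exp (2 * α * a)) / (2 * α) * (κ + d.b * Δ ^ 2) := by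
    rw [intervalIntegral.integral_mul_const, intervalIntegral.integral_comp_mul_left Real.exp
      (by positivity), integral_exp, smul_eq_mul]
    ring
  have hle : ∫ s in a..t, growthRate sys ηm τM α d x s ≤
      ∫ s in a..t, Real.exp (2 * α * s) * (κ + d.b * Δ ^ 2) := by
    -- The flow equation and the bound on $\omega$ are given on half-open intervals closed on the
    -- left.
    rw [intervalIntegral.integral_of_le hat, intervalIntegral.integral_of_le hat,
      ← integral_Ico_eq_integral_Ioc, ← integral_Ico_eq_integral_Ioc]
    refine setIntegral_mono_ae_restrict ?_ ?_ ?_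
    · exact (intervalIntegrable_iff_integrableOn_Ico_of_le hat).1 hI.1
    · exact (intervalIntegrable_iff_integrableOn_Ico_of_le hat).1
        ((hexp.mul continuous_const).intervalIntegrable _ _)
    · refine (ae_restrict_iff' measurableSet_Ico).2 ?_
      filter_upwards [hflow, hω] with s hs1 hs2 hs
      have hxs : AbsolutelyContinuousOnInterval x (s - τM) s := by
        apply hx.mono
        rw [Set.uIcc_of_le (by linarith), Set.uIcc_of_le (by linarith)]
        exact Set.Icc_subset_Icc (by linarith [hs.1]) hs.2.le
      refine (growthRate_le h hα.le hη hτ hxs (intervalIntegrable_of_subinterval hx2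
        (by linarith [hs.1]) (by linarith) hs.2.le) (by linarith [hs.2]) (by linarith [hs.1])
        (hs1 hs)).trans (mul_le_mul_of_nonneg_left ?_ (Real.exp_pos _).le)
      gcongr
      · exact h.b_pos.le
      · exact hs2 hs
  rw [← hI.2, hE] at hle
  have e1 : Real.exp (2 * α * a) = Real.exp (2 * α * t) * Real.exp (-2 * α * (t - a)) := by
    rw [← Real.exp_add]; ring_nf
  refine le_of_mul_le_mul_left ?_ (Real.exp_pos (2 * α * t))
  beta_reduce at hle
  rw [e1] at hle
  have e2 : Real.exp (2 * α * t) * (Real.exp (-2 * α * (t - a)) * V sys ηm τM α d x sk a +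
      (κ + d.b * Δ ^ 2) * ((1 - Real.exp (-2 * α * (t - a))) / (2 * α))) =
      Real.exp (2 * α * t) * Real.exp (-2 * α * (t - a)) * V sys ηm τM α d x sk a +
      (Real.exp (2 * α * t) - Real.exp (2 * α * t) * Real.exp (-2 * α * (t - a))) / (2 * α)
        * (κ + d.b * Δ ^ 2) := by ring
  rw [e2]
  linarith

end Flow

/-! ### Sampling and updating instants. -/

section SamplingFacts

variable {ηm τM : ℝ} (σ : Sampling ηm τM)

lemma Sampling.t_mono : Monotone σ.t := monotone_nat_of_le_succ σ.ordered

lemma Sampling.s_le_t (k : ℕ) : σ.s k ≤ σ.t k - ηm := by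
  have := σ.le_delay k
  unfold Sampling.t
  linarith

/-- With `Sampling.s_le_t`, this places the delay $t-s_k$ in $[\eta_m,\tau_M]$ for all
$t\in[t_k,t_{k+1}]$. -/
lemma Sampling.t_succ_le (k : ℕ) : σ.t (k + 1) - τM ≤ σ.s k := by
  have := σ.span_le k
  unfold Sampling.t
  linarith

lemma Sampling.s_succ_le (k : ℕ) : σ.s (k + 1) - σ.s k ≤ τM - ηm := by
  have := σ.t_succ_le k
  have := σ.s_le_t (k + 1)
  linarith

/-- No sampled state lies before the domain of the initial function, because $s_k\ge s_0\ge
t_1-\tau_M\ge t_0-\tau_M$. -/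
lemma Sampling.t_zero_le_s (k : ℕ) : σ.t 0 - τM ≤ σ.s k := by
  have h1 := σ.t_succ_le 0
  have h2 := σ.ordered 0
  have h3 := σ.s_strictMono.monotone (Nat.zero_le k)
  unfold Sampling.t at *
  linarith

lemma Sampling.t_zero_nonneg (hη : 0 ≤ ηm) : 0 ≤ σ.t 0 := by
  have h1 := σ.s_zero
  have h2 := σ.le_delay 0
  unfold Sampling.t
  linarith

lemma Sampling.exists_lt_t (hη : 0 ≤ ηm) (T : ℝ) : ∃ k, T < σ.t k := by
  obtain ⟨k, hk⟩ := (σ.s_unbounded.eventually_gt_atTop T).exists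
  exact ⟨k, by linarith [σ.s_le_t k]⟩

/-- Updating instants may coincide, so some of these intervals are empty; $k+1$ is the first index
with $t_{k+1}>t$. -/
lemma Sampling.exists_mem_Ico (hη : 0 ≤ ηm) {t : ℝ} (ht : σ.t 0 ≤ t) :
    ∃ k, t ∈ Set.Ico (σ.t k) (σ.t (k + 1)) := by
  classical
  have hex := σ.exists_lt_t hη t
  have hpos : Nat.find hex ≠ 0 := fun h0 => by
    have := Nat.find_spec hex
    rw [h0] at this
    linarith
  obtain ⟨k, hk⟩ := Nat.exists_eq_succ_of_ne_zero hpos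
  refine ⟨k, not_lt.1 (Nat.find_min hex (by omega)), ?_⟩
  have := Nat.find_spec hex
  rwa [hk] at this

end SamplingFacts

variable {N n q : ℕ} {p : Fin N → ℕ} {sys : Plant n q p} {ηm τM α : ℝ} {d : DecisionVars n p}

/-! ### Square integrability of the derivative of a solution. -/

section Solutions

variable {Q : (i : Fin N) → Matrix (Fin (p i)) (Fin (p i)) ℝ} {σ : Sampling ηm τM}
  {ω : ℝ → EuclideanSpace ℝ (Fin q)} {x : ℝ → EuclideanSpace ℝ (Fin n)}
  {e : ℕ → (i : Fin N) → EuclideanSpace ℝ (Fin (p i))} {act : ℕ → Fin N}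

/-- On a bounded time interval only finitely many error values occur, and $x$ and $\omega$ are
(essentially) bounded, so the right-hand side is too. This makes $\dot x$ square integrable beyond
$t_0$, where it is not assumed. -/
lemma IsSolution.exists_bound_deriv (sol : IsSolution sys Q σ ω x e act) (hη : 0 ≤ ηm)
    (hτ : ηm < τM) {T : ℝ} (hT : σ.t 0 ≤ T) :
    ∃ C, ∀ᵐ s : ℝ, s ∈ Set.Ico (σ.t 0) T → ‖deriv x s‖ ≤ C := by
  obtain ⟨M, hM⟩ := (sol.absCont T hT).exists_bound
  obtain ⟨K, hK⟩ := σ.exists_lt_t hη T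
  have hω : ∀ᵐ s : ℝ, s ∈ Set.Ici (0 : ℝ) →
      ‖ω s‖ ≤ (eLpNorm ω ⊤ (volume.restrict (Set.Ici (0 : ℝ)))).toReal := by
    refine (ae_restrict_iff' measurableSet_Ici).1 ?_
    have hfin := sol.disturbance.2
    rw [eLpNorm_exponent_top] at hfin ⊢
    filter_upwards [enorm_ae_le_eLpNormEssSup ω (volume.restrict (Set.Ici (0 : ℝ)))] with s hs
    simpa using ENNReal.toReal_mono hfin.ne hs
  set W := (eLpNorm ω ⊤ (volume.restrict (Set.Ici (0 : ℝ)))).toReal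
  set LA := sys.A.toEuclideanLin.toContinuousLinearMap
  set LA₁ := sys.A₁.toEuclideanLin.toContinuousLinearMap
  set LD := sys.D.toEuclideanLin.toContinuousLinearMap
  set β : ℕ → EuclideanSpace ℝ (Fin n) :=
    fun k => ∑ i ∈ Finset.univ.erase (act k), (sys.B i).toEuclideanLin (e k i)
  refine ⟨‖LA‖ * M + ‖LA₁‖ * M + ∑ k ∈ Finset.range K, ‖β k‖ + ‖LD‖ * W, ?_⟩
  filter_upwards [ae_all_iff.2 sol.flow, hω] with s hs hωs hsT
  obtain ⟨k, hk⟩ := σ.exists_mem_Ico hη hsT.1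
  rw [(hs k hk).deriv]
  have hkK : k < K := by
    by_contra hcon
    have := σ.t_mono (not_lt.1 hcon)
    linarith [hk.1, hsT.2]
  have huIcc : Set.uIcc (σ.t 0 - τM) T = Set.Icc (σ.t 0 - τM) T := Set.uIcc_of_le (by linarith)
  rw [huIcc] at hM
  have hsk := σ.s_le_t k
  have h1 : ‖LA (x s)‖ ≤ ‖LA‖ * M := LA.le_opNorm_of_le (hM s ⟨by linarith [hsT.1], hsT.2.le⟩)
  have h2 : ‖LA₁ (x (σ.s k))‖ ≤ ‖LA₁‖ * M := LA₁.le_opNorm_of_le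
    (hM _ ⟨σ.t_zero_le_s k, by linarith [hk.1, hsT.2]⟩)
  have h3 : ‖LD (ω s)‖ ≤ ‖LD‖ * W := LD.le_opNorm_of_le
    (hωs (by linarith [hsT.1, σ.t_zero_nonneg hη] : (0 : ℝ) ≤ s))
  have h4 : ‖β k‖ ≤ ∑ k ∈ Finset.range K, ‖β k‖ :=
    Finset.single_le_sum (f := fun k => ‖β k‖) (fun _ _ => norm_nonneg _) (Finset.mem_range.2 hkK)
  calc ‖LA (x s) + LA₁ (x (σ.s k)) + β k + LD (ω s)‖
      ≤ ‖LA (x s)‖ + ‖LA₁ (x (σ.s k))‖ + ‖β k‖ + ‖LD (ω s)‖ := norm_add₄_le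
    _ ≤ _ := by linarith

lemma IsSolution.intervalIntegrable_initial (sol : IsSolution sys Q σ ω x e act) (hτ : 0 ≤ τM) :
    IntervalIntegrable (fun s => ‖deriv x s‖ ^ 2) volume (σ.t 0 - τM) (σ.t 0) := by
  rw [intervalIntegrable_iff_integrableOn_Icc_of_le (by linarith)]
  exact (memLp_two_iff_integrable_sq_norm sol.initial.1).1 sol.initial

lemma IsSolution.intervalIntegrable_sq_deriv (sol : IsSolution sys Q σ ω x e act) (hη : 0 ≤ ηm)
    (hτ : ηm < τM) {T : ℝ} (hT : σ.t 0 ≤ T) :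
    IntervalIntegrable (fun s => ‖deriv x s‖ ^ 2) volume (σ.t 0 - τM) T := by
  refine (sol.intervalIntegrable_initial (by linarith)).trans ?_
  obtain ⟨C, hC⟩ := sol.exists_bound_deriv hη hτ hT
  rw [intervalIntegrable_iff_integrableOn_Ico_of_le hT]
  refine Integrable.mono' (g := fun _ => C ^ 2) (integrableOn_const (by simp)) ?_ ?_
  · exact ((measurable_deriv x).norm.pow_const 2).aestronglyMeasurable
  · refine (ae_restrict_iff' measurableSet_Ico).2 ?_
    filter_upwards [hC] with s hs hsT
    rw [Real.norm_of_nonneg (by positivity)]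
    exact pow_le_pow_left₀ (norm_nonneg _) (hs hsT) 2

end Solutions

/-! ### Errors under the TOD protocol. -/

section Protocol

lemma Feasible.U_le (h : Feasible sys ηm τM α d) (i : Fin N) (u : EuclideanSpace ℝ (Fin (p i))) :
    quad (d.U i) u ≤ (1 - 2 * α * (τM - ηm)) / ((N : ℝ) - 1) * quad (d.Q i) u := by
  simpa [bil] using h.omega_le i u 0

lemma Feasible.Q_le (h : Feasible sys ηm τM α d) (i : Fin N) (v : EuclideanSpace ℝ (Fin (p i))) :
    quad (d.Q i) v ≤ Real.exp (-2 * α * τM) * quad (d.G i) v := by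
  simpa [bil] using h.omega_le i 0 v

/-- The active error is the largest, so the $N-1$ others together weigh at most $N-1$ times as much;
the factor $1/(N-1)$ in the first matrix inequality compensates for this. -/
lemma Feasible.tod_sum_le (h : Feasible sys ηm τM α d) (hN : 2 ≤ N) (i : Fin N)
    (e : (j : Fin N) → EuclideanSpace ℝ (Fin (p j)))
    (htod : ∀ j, quad (d.Q j) (e j) ≤ quad (d.Q i) (e i)) :
    (1 - 2 * α * (τM - ηm)) / ((N : ℝ) - 1) * ∑ j ∈ Finset.univ.erase i, quad (d.Q j) (e j)
      ≤ (1 - 2 * α * (τM - ηm)) * quad (d.Q i) (e i) := by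
  have hN' : (0 : ℝ) < (N : ℝ) - 1 := by
    have : (2 : ℝ) ≤ N := by exact_mod_cast hN
    linarith
  rcases le_or_gt 0 (1 - 2 * α * (τM - ηm)) with hc | hc
  · have hcard : ∑ j ∈ Finset.univ.erase i, quad (d.Q j) (e j)
        ≤ ((N : ℝ) - 1) * quad (d.Q i) (e i) := by
      refine (Finset.sum_le_card_nsmul _ _ _ fun j _ => htod j).trans ?_
      rw [Finset.card_erase_of_mem (Finset.mem_univ i), Finset.card_univ, Fintype.card_fin,
        nsmul_eq_mul, Nat.cast_sub (by omega), Nat.cast_one]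
    refine (mul_le_mul_of_nonneg_left hcard (div_nonneg hc hN'.le)).trans (le_of_eq ?_)
    field_simp
  -- With a negative coefficient, $U_j>0$ would be bounded by a nonpositive form, so all errors
  -- vanish.
  · have hz : ∀ j, e j = 0 := by
      intro j
      obtain ⟨c, hc0, hcU⟩ := exists_le_quad (h.U_pos j)
      have h1 := h.U_le j (e j)
      have h2 := quad_nonneg (h.Q_pos j).posSemidef (e j)
      have h3 : (1 - 2 * α * (τM - ηm)) / ((N : ℝ) - 1) * quad (d.Q j) (e j) ≤ 0 :=
        mul_nonpos_of_nonpos_of_nonneg (div_nonpos_of_nonpos_of_nonneg hc.le hN'.le) h2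
      have h4 := hcU (e j)
      have h5 : ‖e j‖ ^ 2 ≤ 0 := by
        by_contra hcon
        have := mul_pos hc0 (not_le.1 hcon)
        linarith
      simpa using le_antisymm h5 (sq_nonneg _)
    simp [hz]

/-- The effect of the resets on the errors under the TOD protocol. -/
lemma Feasible.reset_le (h : Feasible sys ηm τM α d) (hN : 2 ≤ N) (i : Fin N)
    (e e' v : (j : Fin N) → EuclideanSpace ℝ (Fin (p j)))
    (htod : ∀ j, quad (d.Q j) (e j) ≤ quad (d.Q i) (e i))
    (hact : e' i = v i) (hinact : ∀ j, j ≠ i → e' j = e j + v j) :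
    ∑ j, quad (d.Q j) (e' j) + ∑ j ∈ Finset.univ.erase i, quad (d.U j) (e j)
        + 2 * α * (τM - ηm) * quad (d.Q i) (e i)
      ≤ ∑ j, quad (d.Q j) (e j) + Real.exp (-2 * α * τM) * ∑ j, quad (d.G j) (v j) := by
  have htod' := h.tod_sum_le hN i e htod
  -- For an inactive node the first matrix inequality is applied to $(e_j,v_j)$. The sum with
  -- coefficient $(1-2\alpha(\tau_M-\eta_m))/(N-1)$ is charged to the old active error, which the
  -- reset erases.
  have h1 : ∑ j ∈ Finset.univ.erase i, quad (d.Q j) (e' j)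
      + ∑ j ∈ Finset.univ.erase i, quad (d.U j) (e j) ≤
      ∑ j ∈ Finset.univ.erase i, quad (d.Q j) (e j)
      + (1 - 2 * α * (τM - ηm)) / ((N : ℝ) - 1) * ∑ j ∈ Finset.univ.erase i, quad (d.Q j) (e j)
      + Real.exp (-2 * α * τM) * ∑ j ∈ Finset.univ.erase i, quad (d.G j) (v j) := by
    rw [Finset.mul_sum, Finset.mul_sum, ← Finset.sum_add_distrib, ← Finset.sum_add_distrib,
      ← Finset.sum_add_distrib]
    refine Finset.sum_le_sum fun j hj => ?_
    rw [hinact j (Finset.ne_of_mem_erase hj),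
      quad_add (posSemidef_transpose_eq (h.Q_pos j).posSemidef)]
    linarith [h.omega_le j (e j) (v j)]
  have h2 := h.Q_le i (v i)
  have e1 := Finset.univ.add_sum_erase (fun j => quad (d.Q j) (e' j)) (Finset.mem_univ i)
  have e2 := Finset.univ.add_sum_erase (fun j => quad (d.Q j) (e j)) (Finset.mem_univ i)
  have e3 := Finset.univ.add_sum_erase (fun j => quad (d.G j) (v j)) (Finset.mem_univ i)
  rw [← e1, ← e2, ← e3, hact]
  linarith

lemma Feasible.U_le_Q (h : Feasible sys ηm τM α d) (hN : 2 ≤ N) (hα : 0 ≤ α) (hτ : ηm < τM)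
    (i : Fin N) (u : EuclideanSpace ℝ (Fin (p i))) : quad (d.U i) u ≤ quad (d.Q i) u := by
  refine (h.U_le i u).trans (mul_le_of_le_one_left (quad_nonneg (h.Q_pos i).posSemidef u) ?_)
  have hN' : (1 : ℝ) ≤ (N : ℝ) - 1 := by
    have : (2 : ℝ) ≤ N := by exact_mod_cast hN
    linarith
  rw [div_le_iff₀ (by linarith)]
  nlinarith [mul_nonneg hα (sub_pos.2 hτ).le]

end Protocol

/-! ### Decay along the hybrid trajectory. -/

section Decay

variable {σ : Sampling ηm τM}
  {ω : ℝ → EuclideanSpace ℝ (Fin q)} {x : ℝ → EuclideanSpace ℝ (Fin n)}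
  {e : ℕ → (i : Fin N) → EuclideanSpace ℝ (Fin (p i))} {act : ℕ → Fin N} {T Δ : ℝ}

/-- Only $V_G$ changes: it loses the integrals over $[s_k,s_{k+1}]$. Jensen's inequality bounds them
below, the weight being at least $e^{2\alpha(t_{k+1}-\tau_M)}$ there, and the factor $\tau_M-\eta_m$
is at least the length $s_{k+1}-s_k$. -/
lemma V_jump_le (h : Feasible sys ηm τM α d) (hα : 0 ≤ α) (hη : 0 ≤ ηm)
    (hτ : ηm < τM) (sol : IsSolution sys d.Q σ ω x e act) (k : ℕ) :
    V sys ηm τM α d x (σ.s (k + 1)) (σ.t (k + 1))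
        + Real.exp (-2 * α * τM) * ∑ i, quad (d.G i)
          ((sys.C i).toEuclideanLin (x (σ.s k) - x (σ.s (k + 1))))
      ≤ V sys ηm τM α d x (σ.s k) (σ.t (k + 1)) := by
  set t := σ.t (k + 1) with ht
  set u := σ.s k
  set v := σ.s (k + 1) with hv
  have hT : σ.t 0 ≤ t := σ.t_mono (Nat.zero_le _)
  have huv : u ≤ v := (σ.s_strictMono (Nat.lt_succ_self k)).le
  have hvt : v ≤ t := by linarith [σ.s_le_t (k + 1)]
  have hlu : σ.t 0 - τM ≤ u := σ.t_zero_le_s k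
  have hx2 := sol.intervalIntegrable_sq_deriv hη hτ hT
  have hx := sol.absCont t hT
  have hxuv : AbsolutelyContinuousOnInterval x u v := by
    apply hx.mono
    rw [Set.uIcc_of_le huv, Set.uIcc_of_le (by linarith)]
    exact Set.Icc_subset_Icc hlu hvt
  refine le_of_mul_le_mul_left ?_ (Real.exp_pos (2 * α * t))
  rw [mul_add, exp_mul_V, exp_mul_V]
  suffices hs : Real.exp (2 * α * t) * (Real.exp (-2 * α * τM) * ∑ i, quad (d.G i)
      ((sys.C i).toEuclideanLin (x u - x v))) +
      ∑ i, (τM - ηm) * ∫ s in v..t,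
        Real.exp (2 * α * s) * quad ((sys.C i)ᵀ * d.G i * sys.C i) (deriv x s) ≤
      ∑ i, (τM - ηm) * ∫ s in u..t,
        Real.exp (2 * α * s) * quad ((sys.C i)ᵀ * d.G i * sys.C i) (deriv x s) by linarith
  rw [← mul_assoc, Finset.mul_sum, ← Finset.sum_add_distrib]
  refine Finset.sum_le_sum fun i _ => ?_
  have hM := posSemidef_conj h i
  have hg : ∀ {y z : ℝ}, u ≤ y → y ≤ z → z ≤ t → IntervalIntegrable (fun s =>
      Real.exp (2 * α * s) * quad ((sys.C i)ᵀ * d.G i * sys.C i) (deriv x s)) volume y z :=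
    fun h1 h2 h3 => (intervalIntegrable_quad_deriv (intervalIntegrable_of_subinterval hx2
      (by linarith) h2 h3)).continuousOn_mul (by fun_prop)
  have hJ := exp_mul_quad_sub_le_integral (t := t) (c := τM) hα hM huv hxuv
    (intervalIntegrable_of_subinterval hx2 hlu huv hvt) (σ.t_succ_le k)
  have hnn : 0 ≤ ∫ s in u..v,
      Real.exp (2 * α * s) * quad ((sys.C i)ᵀ * d.G i * sys.C i) (deriv x s) :=
    intervalIntegral.integral_nonneg huv fun s _ =>
      mul_nonneg (Real.exp_pos _).le (quad_nonneg hM _)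
  have hle := mul_le_mul_of_nonneg_right (σ.s_succ_le k) hnn
  rw [← intervalIntegral.integral_add_adjacent_intervals (hg le_rfl huv hvt) (hg huv hvt le_rfl),
    ← quad_conj, ← neg_sub, quad_neg, ← Real.exp_add]
  have e1 : 2 * α * t + -2 * α * τM = 2 * α * (t - τM) := by ring
  rw [e1]
  linarith

/-- The bound on `V` between two updates, with the weighted errors of the inactive nodes. -/
lemma V_add_errors_le (h : Feasible sys ηm τM α d) (hα : 0 < α) (hη : 0 ≤ ηm) (hτ : ηm < τM)
    (sol : IsSolution sys d.Q σ ω x e act)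
    (hΔ : ∀ᵐ s : ℝ, s ∈ Set.Ico (σ.t 0) T → ‖ω s‖ ≤ Δ) (k : ℕ) {t : ℝ}
    (ht : t ∈ Set.Icc (σ.t k) (σ.t (k + 1))) (htT : t ≤ T) :
    V sys ηm τM α d x (σ.s k) t + ∑ j ∈ Finset.univ.erase (act k), quad (d.Q j) (e k j)
      ≤ Real.exp (-2 * α * (t - σ.t k)) * (V sys ηm τM α d x (σ.s k) (σ.t k)
          + ∑ j ∈ Finset.univ.erase (act k), quad (d.Q j) (e k j))
        + ∑ j ∈ Finset.univ.erase (act k), quad (d.U j) (e k j)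
        + d.b / (2 * α) * Δ ^ 2 * (1 - Real.exp (-2 * α * (t - σ.t k))) := by
  have hT : σ.t 0 ≤ t := (σ.t_mono (Nat.zero_le k)).trans ht.1
  have htk : σ.t 0 ≤ σ.t k := σ.t_mono (Nat.zero_le k)
  have hflow : ∀ᵐ s : ℝ, s ∈ Set.Ico (σ.t k) t → HasDerivAt x (sys.A.toEuclideanLin (x s)
      + sys.A₁.toEuclideanLin (x (σ.s k))
      + ∑ j ∈ Finset.univ.erase (act k), (sys.B j).toEuclideanLin (e k j)
      + sys.D.toEuclideanLin (ω s)) s := by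
    filter_upwards [sol.flow k] with s hs hst
    exact hs ⟨hst.1, hst.2.trans_le ht.2⟩
  have hω : ∀ᵐ s : ℝ, s ∈ Set.Ico (σ.t k) t → ‖ω s‖ ≤ Δ := by
    filter_upwards [hΔ] with s hs hst
    exact hs ⟨htk.trans hst.1, hst.2.trans_le htT⟩
  have hV := V_le_of_flow h hα hη hτ (sol.absCont t hT) (sol.intervalIntegrable_sq_deriv hη hτ hT)
    (by linarith) ht.1 (by linarith [σ.t_succ_le k, ht.2]) (σ.s_le_t k) hflow hω
  set E := Real.exp (-2 * α * (t - σ.t k)) with hE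
  -- As $1-e^{-r}\le r$, the left-hand side is at most $t-t_k$. Hence the integrated $U_j$ terms,
  -- divided by $\tau_M-\eta_m$, count at most once.
  have hgle : (1 - E) / (2 * α) ≤ τM - ηm := by
    have h1 := Real.add_one_le_exp (-2 * α * (t - σ.t k))
    have h2 : t - σ.t k ≤ τM - ηm := by
      linarith [σ.t_succ_le k, σ.s_le_t k, ht.2]
    rw [div_le_iff₀ (by positivity)]
    nlinarith
  have hU : 0 ≤ ∑ j ∈ Finset.univ.erase (act k), quad (d.U j) (e k j) :=
    Finset.sum_nonneg fun j _ => quad_nonneg (h.U_pos j).posSemidef _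
  have hτη : 0 < τM - ηm := sub_pos.2 hτ
  have h3 : (1 - E) / (2 * α) / (τM - ηm) * ∑ j ∈ Finset.univ.erase (act k), quad (d.U j) (e k j)
      ≤ ∑ j ∈ Finset.univ.erase (act k), quad (d.U j) (e k j) :=
    mul_le_of_le_one_left hU ((div_le_one hτη).2 hgle)
  have h4 : (∑ j ∈ Finset.univ.erase (act k), (1 / (τM - ηm) * quad (d.U j) (e k j)
        - 2 * α * quad (d.Q j) (e k j)) + d.b * Δ ^ 2) * ((1 - E) / (2 * α)) =
      (1 - E) / (2 * α) / (τM - ηm) * ∑ j ∈ Finset.univ.erase (act k), quad (d.U j) (e k j)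
      - (1 - E) * ∑ j ∈ Finset.univ.erase (act k), quad (d.Q j) (e k j)
      + d.b / (2 * α) * Δ ^ 2 * (1 - E) := by
    rw [Finset.sum_sub_distrib, ← Finset.mul_sum, ← Finset.mul_sum]
    field_simp
  rw [h4] at hV
  linarith

/-- The $U_j$ terms from the flow cancel against those in `Feasible.reset_le`. The active error is
absent from the flow estimate, but the reset leaves only $1-2\alpha(\tau_M-\eta_m)$ times its
weight, and this factor is at most $e^{-2\alpha(t_{k+1}-t_k)}$. -/
lemma Ve_succ_le (hN : 2 ≤ N) (h : Feasible sys ηm τM α d) (hα : 0 < α) (hη : 0 ≤ ηm)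
    (hτ : ηm < τM) (sol : IsSolution sys d.Q σ ω x e act)
    (hΔ : ∀ᵐ s : ℝ, s ∈ Set.Ico (σ.t 0) T → ‖ω s‖ ≤ Δ) (k : ℕ) (hT : σ.t (k + 1) ≤ T) :
    Ve sys ηm τM α d x (σ.s (k + 1)) (σ.t (k + 1)) (e (k + 1))
      ≤ Real.exp (-2 * α * (σ.t (k + 1) - σ.t k)) * Ve sys ηm τM α d x (σ.s k) (σ.t k) (e k)
        + d.b / (2 * α) * Δ ^ 2 * (1 - Real.exp (-2 * α * (σ.t (k + 1) - σ.t k))) := by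
  have hV := V_add_errors_le h hα hη hτ sol hΔ k (t := σ.t (k + 1))
    ⟨σ.t_mono (Nat.le_succ k), le_rfl⟩ hT
  have hJ := V_jump_le h hα.le hη hτ sol k
  have hR := h.reset_le hN (act k) (e k) (e (k + 1))
    (fun j => (sys.C j).toEuclideanLin (x (σ.s k) - x (σ.s (k + 1))))
    (sol.tod k) (sol.reset_active k) (sol.reset_inactive k)
  have hQ := quad_nonneg (h.Q_pos (act k)).posSemidef (e k (act k))
  have h1 := Real.add_one_le_exp (-2 * α * (σ.t (k + 1) - σ.t k))
  have h2 : σ.t (k + 1) - σ.t k ≤ τM - ηm := by linarith [σ.t_succ_le k, σ.s_le_t k]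
  have h3 : 1 - 2 * α * (τM - ηm) ≤ Real.exp (-2 * α * (σ.t (k + 1) - σ.t k)) := by nlinarith
  have h4 := mul_le_mul_of_nonneg_right h3 hQ
  have e2 := Finset.univ.add_sum_erase (fun j => quad (d.Q j) (e k j)) (Finset.mem_univ (act k))
  rw [Ve, Ve, ← e2]
  rw [← e2] at hR
  beta_reduce at hR ⊢
  linarith

/-- The factor $1-E$ keeps the disturbance terms from accumulating: $E'(1-E)+(1-E') = 1-E'E$. -/
lemma Ve_le (hN : 2 ≤ N) (h : Feasible sys ηm τM α d) (hα : 0 < α) (hη : 0 ≤ ηm)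
    (hτ : ηm < τM) (sol : IsSolution sys d.Q σ ω x e act)
    (hΔ : ∀ᵐ s : ℝ, s ∈ Set.Ico (σ.t 0) T → ‖ω s‖ ≤ Δ) (k : ℕ) (hT : σ.t k ≤ T) :
    Ve sys ηm τM α d x (σ.s k) (σ.t k) (e k)
      ≤ Real.exp (-2 * α * (σ.t k - σ.t 0)) * Ve sys ηm τM α d x (σ.s 0) (σ.t 0) (e 0)
        + d.b / (2 * α) * Δ ^ 2 * (1 - Real.exp (-2 * α * (σ.t k - σ.t 0))) := by
  induction k with
  | zero => simp
  | succ k ih =>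
    have h1 := Ve_succ_le hN h hα hη hτ sol hΔ k hT
    have h2 := mul_le_mul_of_nonneg_left (ih ((σ.t_mono (Nat.le_succ k)).trans hT))
      (Real.exp_pos (-2 * α * (σ.t (k + 1) - σ.t k))).le
    have e1 : Real.exp (-2 * α * (σ.t (k + 1) - σ.t 0)) =
        Real.exp (-2 * α * (σ.t (k + 1) - σ.t k)) * Real.exp (-2 * α * (σ.t k - σ.t 0)) := by
      rw [← Real.exp_add]; ring_nf
    rw [e1]
    linarith

/-- Before the next reset nothing has yet paid for the $U_j$ terms. Since $U_j\le Q_j$, they are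
absorbed by the errors of the inactive nodes on the left of `V_add_errors_le`. -/
lemma V_le (hN : 2 ≤ N) (h : Feasible sys ηm τM α d) (hα : 0 < α) (hη : 0 ≤ ηm)
    (hτ : ηm < τM) (sol : IsSolution sys d.Q σ ω x e act)
    (hΔ : ∀ᵐ s : ℝ, s ∈ Set.Ico (σ.t 0) T → ‖ω s‖ ≤ Δ) (k : ℕ) {t : ℝ}
    (ht : t ∈ Set.Icc (σ.t k) (σ.t (k + 1))) (htT : t ≤ T) :
    V sys ηm τM α d x (σ.s k) t
      ≤ Real.exp (-2 * α * (t - σ.t 0)) * Ve sys ηm τM α d x (σ.s 0) (σ.t 0) (e 0)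
        + d.b / (2 * α) * Δ ^ 2 := by
  have hV := V_add_errors_le h hα hη hτ sol hΔ k ht htT
  have h1 := mul_le_mul_of_nonneg_left (Ve_le hN h hα hη hτ sol hΔ k (ht.1.trans htT))
    (Real.exp_pos (-2 * α * (t - σ.t k))).le
  have e1 : Real.exp (-2 * α * (t - σ.t 0)) =
      Real.exp (-2 * α * (t - σ.t k)) * Real.exp (-2 * α * (σ.t k - σ.t 0)) := by
    rw [← Real.exp_add]; ring_nf
  have e2 := Finset.univ.add_sum_erase (fun j => quad (d.Q j) (e k j)) (Finset.mem_univ (act k))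
  rw [Ve, ← e2] at h1
  have hU : ∑ j ∈ Finset.univ.erase (act k), quad (d.U j) (e k j) ≤
      ∑ j ∈ Finset.univ.erase (act k), quad (d.Q j) (e k j) := by
    refine Finset.sum_le_sum fun j _ => ?_
    exact h.U_le_Q hN hα.le hτ j (e k j)
  have hQ := quad_nonneg (h.Q_pos (act k)).posSemidef (e k (act k))
  have hEQ := mul_nonneg (Real.exp_pos (-2 * α * (t - σ.t k))).le hQ
  have hb : 0 ≤ d.b / (2 * α) * Δ ^ 2 := by
    have := h.b_pos
    positivity
  have hbE := mul_nonneg hb (mul_nonneg (Real.exp_pos (-2 * α * (t - σ.t k))).le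
    (Real.exp_pos (-2 * α * (σ.t k - σ.t 0))).le)
  rw [e1]
  linarith

theorem Feasible.expBound (hN : 2 ≤ N) (h : Feasible sys ηm τM α d) (hα : 0 < α) (hη : 0 ≤ ηm)
    (hτ : ηm < τM) : ExpBound sys ηm τM α d := by
  intro σ ω x e act sol Δ hΔ k t ht
  refine V_le hN h hα hη hτ sol (T := t) ?_ k ⟨ht.1, ht.2.le⟩ le_rfl
  filter_upwards [hΔ] with s hs hst
  exact hs ((σ.t_zero_nonneg hη).trans hst.1)

end Decay

/-! ### Comparison of the functional with norms, and ISS. -/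

section Bounds

lemma Feasible.exists_le_V (h : Feasible sys ηm τM α d) (hη : 0 ≤ ηm) (hτ : ηm < τM) :
    ∃ c > 0, ∀ (x : ℝ → EuclideanSpace ℝ (Fin n)) (sk t : ℝ), sk ≤ t →
      c * ‖x t‖ ^ 2 ≤ V sys ηm τM α d x sk t := by
  obtain ⟨c, hc, hcP⟩ := exists_le_quad h.P_pos
  refine ⟨c, hc, fun x sk t hsk => ?_⟩
  have hq : ∀ {m : ℕ} {M : Matrix (Fin m) (Fin m) ℝ}, M.PosDef →
      ∀ (f : ℝ → EuclideanSpace ℝ (Fin m)) (s : ℝ),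
      0 ≤ Real.exp (2 * α * (s - t)) * quad M (f s) :=
    fun hM f s => mul_nonneg (Real.exp_pos _).le (quad_nonneg hM.posSemidef _)
  have hi : ∀ {m : ℕ} {M : Matrix (Fin m) (Fin m) ℝ}, M.PosDef →
      ∀ (f : ℝ → EuclideanSpace ℝ (Fin m)) {a b : ℝ}, a ≤ b →
      0 ≤ ∫ s in a..b, Real.exp (2 * α * (s - t)) * quad M (f s) :=
    fun hM f _ _ hab => intervalIntegral.integral_nonneg hab fun s _ => hq hM f s
  have h1 := hi h.S₀_pos x (a := t - ηm) (b := t) (by linarith)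
  have h2 := hi h.S₁_pos x (a := t - τM) (b := t - ηm) (by linarith)
  have h3 : 0 ≤ ηm * ∫ θ in (-ηm)..0, ∫ s in (t + θ)..t,
      Real.exp (2 * α * (s - t)) * quad d.R₀ (deriv x s) :=
    mul_nonneg hη (intervalIntegral.integral_nonneg (by linarith)
      fun θ hθ => hi h.R₀_pos (deriv x) (by linarith [hθ.2]))
  have h4 : 0 ≤ (τM - ηm) * ∫ θ in (-τM)..(-ηm), ∫ s in (t + θ)..t,
      Real.exp (2 * α * (s - t)) * quad d.R₁ (deriv x s) :=
    mul_nonneg (by linarith) (intervalIntegral.integral_nonneg (by linarith)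
      fun θ hθ => hi h.R₁_pos (deriv x) (by linarith [hθ.2]))
  have h5 : 0 ≤ VG sys ηm τM α d x sk t := Finset.sum_nonneg fun i _ =>
    mul_nonneg (by linarith) (hi (h.G_pos i) (fun s => (sys.C i).toEuclideanLin (deriv x s)) hsk)
  have h6 := hcP (x t)
  rw [V, VTilde]
  linarith

lemma exp_weight_le_one (hα : 0 ≤ α) {s t : ℝ} (hst : s ≤ t) :
    Real.exp (2 * α * (s - t)) ≤ 1 :=
  Real.exp_le_one_iff.2 (mul_nonpos_of_nonneg_of_nonpos (by positivity) (by linarith))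

lemma weighted_integral_le (hα : 0 ≤ α) {M : Matrix (Fin n) (Fin n) ℝ} {c : ℝ} (hc : 0 ≤ c)
    (hM : ∀ v : EuclideanSpace ℝ (Fin n), |quad M v| ≤ c * ‖v‖ ^ 2)
    {x : ℝ → EuclideanSpace ℝ (Fin n)} {a b t w : ℝ} (hab : a ≤ b) (hbt : b ≤ t)
    (hx : ∀ s ∈ Set.Icc a b, ‖x s‖ ≤ w) :
    ∫ s in a..b, Real.exp (2 * α * (s - t)) * quad M (x s) ≤ (b - a) * c * w ^ 2 := by
  have h := intervalIntegral.norm_integral_le_of_norm_le_const (a := a) (b := b)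
    (f := fun s => Real.exp (2 * α * (s - t)) * quad M (x s)) (C := c * w ^ 2) fun s hs => by
      rw [Set.uIoc_of_le hab] at hs
      rw [norm_mul, Real.norm_eq_abs, Real.norm_eq_abs, abs_of_pos (Real.exp_pos _)]
      refine (mul_le_of_le_one_left (abs_nonneg _) (exp_weight_le_one hα (hs.2.trans hbt))).trans
        ((hM _).trans ?_)
      gcongr
      exact hx s ⟨hs.1.le, hs.2⟩
  rw [abs_of_nonneg (sub_nonneg.2 hab)] at h
  linarith [(le_abs_self _).trans h]

lemma abs_weighted_integral_deriv_le (hα : 0 ≤ α) {M : Matrix (Fin n) (Fin n) ℝ} {c : ℝ}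
    (hc : 0 ≤ c) (hM : ∀ v : EuclideanSpace ℝ (Fin n), |quad M v| ≤ c * ‖v‖ ^ 2)
    {x : ℝ → EuclideanSpace ℝ (Fin n)} {l a t : ℝ} (hla : l ≤ a) (hat : a ≤ t)
    (hx2 : IntervalIntegrable (fun s => ‖deriv x s‖ ^ 2) volume l t) :
    |∫ s in a..t, Real.exp (2 * α * (s - t)) * quad M (deriv x s)| ≤
      c * ∫ s in l..t, ‖deriv x s‖ ^ 2 := by
  have h2 := intervalIntegrable_of_subinterval hx2 hla hat le_rfl
  have h1 : |∫ s in a..t, Real.exp (2 * α * (s - t)) * quad M (deriv x s)| ≤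
      ∫ s in a..t, c * ‖deriv x s‖ ^ 2 := by
    rw [← Real.norm_eq_abs]
    refine intervalIntegral.norm_integral_le_of_norm_le hat
      (Filter.Eventually.of_forall fun s hs => ?_) (h2.const_mul c)
    rw [norm_mul, Real.norm_eq_abs, Real.norm_eq_abs, abs_of_pos (Real.exp_pos _)]
    exact (mul_le_of_le_one_left (abs_nonneg _) (exp_weight_le_one hα hs.2)).trans (hM _)
  rw [intervalIntegral.integral_const_mul] at h1
  refine h1.trans (mul_le_mul_of_nonneg_left ?_ hc)
  exact intervalIntegral.integral_mono_interval hla hat le_rfl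
    (Filter.Eventually.of_forall fun s => by positivity) hx2

lemma weighted_double_integral_deriv_le (hα : 0 ≤ α) {M : Matrix (Fin n) (Fin n) ℝ} {c : ℝ}
    (hc : 0 ≤ c) (hM : ∀ v : EuclideanSpace ℝ (Fin n), |quad M v| ≤ c * ‖v‖ ^ 2)
    {x : ℝ → EuclideanSpace ℝ (Fin n)} {l t a b : ℝ} (hla : l ≤ t - a) (hb : 0 ≤ b) (hab : b ≤ a)
    (hx2 : IntervalIntegrable (fun s => ‖deriv x s‖ ^ 2) volume l t) :
    ∫ θ in (-a)..(-b), ∫ s in (t + θ)..t, Real.exp (2 * α * (s - t)) * quad M (deriv x s) ≤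
      (a - b) * (c * ∫ s in l..t, ‖deriv x s‖ ^ 2) := by
  have h := intervalIntegral.norm_integral_le_of_norm_le_const (a := -a) (b := -b)
    (f := fun θ => ∫ s in (t + θ)..t, Real.exp (2 * α * (s - t)) * quad M (deriv x s))
    (C := c * ∫ s in l..t, ‖deriv x s‖ ^ 2) fun θ hθ => by
      rw [Set.uIoc_of_le (by linarith)] at hθ
      exact abs_weighted_integral_deriv_le hα hc hM (by linarith [hθ.1]) (by linarith [hθ.2]) hx2
  rw [abs_of_nonneg (by linarith : (0 : ℝ) ≤ -b - -a)] at h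
  linarith [(le_abs_self _).trans h]

/-- `V` is bounded by a multiple of the squared norm of the past of the state. -/
lemma exists_V_le (sys : Plant n q p) (d : DecisionVars n p) (hα : 0 ≤ α) (hη : 0 ≤ ηm)
    (hτ : ηm < τM) : ∃ K ≥ 0, ∀ (x : ℝ → EuclideanSpace ℝ (Fin n)) (sk t w : ℝ),
      t - τM ≤ sk → sk ≤ t → IntervalIntegrable (fun s => ‖deriv x s‖ ^ 2) volume (t - τM) t →
      (∀ s ∈ Set.Icc (t - τM) t, ‖x s‖ ≤ w) → ∫ s in (t - τM)..t, ‖deriv x s‖ ^ 2 ≤ w ^ 2 →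
      V sys ηm τM α d x sk t ≤ K * w ^ 2 := by
  obtain ⟨cP, hP0, hP⟩ := exists_quad_le d.P
  obtain ⟨cS₀, hS₀0, hS₀⟩ := exists_quad_le d.S₀
  obtain ⟨cS₁, hS₁0, hS₁⟩ := exists_quad_le d.S₁
  obtain ⟨cR₀, hR₀0, hR₀⟩ := exists_quad_le d.R₀
  obtain ⟨cR₁, hR₁0, hR₁⟩ := exists_quad_le d.R₁
  choose cG hG0 hG using fun i => exists_quad_le ((sys.C i)ᵀ * d.G i * sys.C i)
  have hτη : 0 ≤ τM - ηm := by linarith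
  refine ⟨cP + ηm * cS₀ + (τM - ηm) * cS₁ + ηm * (ηm * cR₀) + (τM - ηm) * ((τM - ηm) * cR₁)
    + ∑ i, (τM - ηm) * cG i, ?_, fun x sk t w h1 h2 hx2 hxw hw => ?_⟩
  · have : 0 ≤ ∑ i, (τM - ηm) * cG i := Finset.sum_nonneg fun i _ => mul_nonneg hτη (hG0 i).le
    positivity
  have bP : quad d.P (x t) ≤ cP * w ^ 2 := by
    refine (le_abs_self _).trans ((hP _).trans ?_)
    gcongr
    exact hxw t ⟨by linarith, le_rfl⟩
  have bS₀ := weighted_integral_le hα hS₀0.le hS₀ (x := x) (a := t - ηm) (b := t) (w := w)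
    (by linarith) le_rfl fun s hs => hxw s ⟨by linarith [hs.1], hs.2⟩
  have bS₁ := weighted_integral_le hα hS₁0.le hS₁ (x := x) (a := t - τM) (b := t - ηm) (t := t)
    (w := w) (by linarith) (by linarith) fun s hs => hxw s ⟨hs.1, by linarith [hs.2]⟩
  have bR₀ := weighted_double_integral_deriv_le hα hR₀0.le hR₀ (x := x) (l := t - τM) (t := t)
    (a := ηm) (b := 0) (by linarith) le_rfl hη hx2
  have bR₁ := weighted_double_integral_deriv_le hα hR₁0.le hR₁ (x := x) (l := t - τM) (t := t)
    (a := τM) (b := ηm) le_rfl hη hτ.le hx2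
  have bG : VG sys ηm τM α d x sk t ≤ (∑ i, (τM - ηm) * cG i) * w ^ 2 := by
    rw [VG, Finset.sum_mul]
    refine Finset.sum_le_sum fun i _ => ?_
    rw [mul_assoc]
    refine mul_le_mul_of_nonneg_left ?_ hτη
    simp only [← quad_conj]
    exact (le_abs_self _).trans ((abs_weighted_integral_deriv_le hα (hG0 i).le (hG i) h1 h2
      hx2).trans (mul_le_mul_of_nonneg_left hw (hG0 i).le))
  have bR₀' := mul_le_mul_of_nonneg_left (bR₀.trans (mul_le_mul_of_nonneg_left
    (mul_le_mul_of_nonneg_left hw hR₀0.le) (by linarith : (0 : ℝ) ≤ ηm - 0))) hη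
  have bR₁' := mul_le_mul_of_nonneg_left (bR₁.trans (mul_le_mul_of_nonneg_left
    (mul_le_mul_of_nonneg_left hw hR₁0.le) hτη)) hτη
  rw [neg_zero] at bR₀'
  rw [V, VTilde]
  linarith

lemma norm_le_normW {x : ℝ → EuclideanSpace ℝ (Fin n)} {t₀ : ℝ}
    (hx : ContinuousOn x (Set.Icc (t₀ - τM) t₀)) {s : ℝ} (hs : s ∈ Set.Icc (t₀ - τM) t₀) :
    ‖x s‖ ≤ normW x τM t₀ := by
  have hb := (isCompact_Icc.image_of_continuousOn hx.norm).bddAbove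
  have := le_csSup hb (Set.mem_image_of_mem (fun s => ‖x s‖) hs)
  exact this.trans (le_add_of_nonneg_right (Real.sqrt_nonneg _))

lemma integral_sq_deriv_le_normW {x : ℝ → EuclideanSpace ℝ (Fin n)} {t₀ : ℝ} (hτ : 0 ≤ τM) :
    ∫ s in (t₀ - τM)..t₀, ‖deriv x s‖ ^ 2 ≤ normW x τM t₀ ^ 2 := by
  have h0 : 0 ≤ ∫ s in (t₀ - τM)..t₀, ‖deriv x s‖ ^ 2 :=
    intervalIntegral.integral_nonneg (by linarith) fun s _ => by positivity
  have h1 : 0 ≤ sSup ((fun s => ‖x s‖) '' Set.Icc (t₀ - τM) t₀) :=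
    Real.sSup_nonneg (by rintro _ ⟨s, -, rfl⟩; exact norm_nonneg _)
  rw [← Real.sq_sqrt h0]
  exact pow_le_pow_left₀ (Real.sqrt_nonneg _) (le_add_of_nonneg_left h1) 2

lemma ae_norm_le_essNorm {ω : ℝ → EuclideanSpace ℝ (Fin q)} {t₀ t : ℝ}
    (hω : MemLp ω ⊤ (volume.restrict (Set.Ici (0 : ℝ)))) (ht₀ : 0 ≤ t₀) :
    ∀ᵐ s : ℝ, s ∈ Set.Icc t₀ t → ‖ω s‖ ≤ essNorm ω t₀ t := by
  refine (ae_restrict_iff' measurableSet_Icc).1 ?_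
  have hfin := (hω.mono_measure (Measure.restrict_mono
    (fun s hs => ht₀.trans hs.1 : Set.Icc t₀ t ⊆ Set.Ici 0) le_rfl)).2
  unfold essNorm
  rw [eLpNorm_exponent_top] at hfin ⊢
  filter_upwards [enorm_ae_le_eLpNormEssSup ω (volume.restrict (Set.Icc t₀ t))] with s hs
  simpa using ENNReal.toReal_mono hfin.ne hs

end Bounds

/-- The state is controlled by $V(t)\ge c|x(t)|^2$, the errors by $V_e(t_k)$ and $Q_i>0$. Taking the
end time $T=t$ in the decay lemmas leaves only the essential supremum of $|\omega|$ on $[t_0,t]$. -/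
theorem Feasible.iss (hN : 2 ≤ N) (h : Feasible sys ηm τM α d) (hα : 0 < α) (hη : 0 ≤ ηm)
    (hτ : ηm < τM) : ISS sys ηm τM d.Q := by
  obtain ⟨c, hc, hcV⟩ := h.exists_le_V hη hτ
  obtain ⟨K, hK, hKV⟩ := exists_V_le sys d hα.le hη hτ
  choose cQ hcQ hQ using fun i => exists_quad_le (d.Q i)
  choose bQ hbQ hQ' using fun i => exists_le_quad (h.Q_pos i)
  have hb := h.b_pos
  have hsQ : 0 ≤ ∑ i, cQ i := Finset.sum_nonneg fun i _ => (hcQ i).le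
  have hsB : 0 ≤ ∑ i, (bQ i)⁻¹ := Finset.sum_nonneg fun i _ => (inv_pos.2 (hbQ i)).le
  set L := K + ∑ i, cQ i + 1 with hL
  have hL0 : 0 < L := by positivity
  set B := c⁻¹ + ∑ i, (bQ i)⁻¹ with hB
  have hcB : c⁻¹ ≤ B := by linarith
  have hBB : ∑ i, (bQ i)⁻¹ ≤ B := by linarith [inv_pos.2 hc]
  have hB0 : 0 < B := by have := inv_pos.2 hc; positivity
  -- The errors are frozen at $t_k$, which precedes $t$ by at most $\tau_M$; this factor converts
  -- decay up to $t_k$ into decay up to $t$.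
  set X := Real.exp (2 * α * τM)
  have hX1 : 1 ≤ X := Real.one_le_exp (by have : 0 ≤ τM := by linarith
                                          positivity)
  refine ⟨B * X * L, by positivity, 2 * α, by positivity, B * (d.b / (2 * α)), by positivity,
    fun σ ω x e act sol => ?_⟩
  have ht0 := σ.t_zero_nonneg hη
  have hτ0 : 0 ≤ τM := by linarith
  have hxc : ContinuousOn x (Set.Icc (σ.t 0 - τM) (σ.t 0)) := by
    have := (sol.absCont _ le_rfl).continuousOn
    rwa [Set.uIcc_of_le (by linarith)] at this
  set Z := normW x τM (σ.t 0) ^ 2 + ∑ i, ‖e 0 i‖ ^ 2 with hZ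
  have hZe : 0 ≤ ∑ i, ‖e 0 i‖ ^ 2 := Finset.sum_nonneg fun i _ => by positivity
  have hZ0 : 0 ≤ Z := by positivity
  have hVe0 : Ve sys ηm τM α d x (σ.s 0) (σ.t 0) (e 0) ≤ L * Z := by
    have h1 := hKV x (σ.s 0) (σ.t 0) (normW x τM (σ.t 0)) (σ.t_zero_le_s 0)
      (by linarith [σ.s_le_t 0]) (sol.intervalIntegrable_initial hτ0)
      (fun s hs => norm_le_normW hxc hs) (integral_sq_deriv_le_normW hτ0)
    have h2 : ∑ i, quad (d.Q i) (e 0 i) ≤ (∑ i, cQ i) * ∑ i, ‖e 0 i‖ ^ 2 := by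
      rw [Finset.sum_mul]
      refine Finset.sum_le_sum fun i _ => ((le_abs_self _).trans (hQ i _)).trans ?_
      exact mul_le_mul_of_nonneg_left (Finset.single_le_sum (f := fun i => ‖e 0 i‖ ^ 2)
        (fun _ _ => by positivity) (Finset.mem_univ i)) (hcQ i).le
    have h3 : 0 ≤ normW x τM (σ.t 0) ^ 2 := by positivity
    rw [Ve, hL, hZ]
    nlinarith [mul_nonneg hK hZe, mul_nonneg hsQ h3]
  have hΔ : ∀ t, ∀ᵐ s : ℝ, s ∈ Set.Ico (σ.t 0) t → ‖ω s‖ ≤ essNorm ω (σ.t 0) t := fun t => by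
    filter_upwards [ae_norm_le_essNorm (t := t) sol.disturbance ht0] with s hs hst
    exact hs ⟨hst.1, hst.2.le⟩
  refine ⟨fun t ht => ?_, fun k t ht => ?_⟩
  · obtain ⟨k, hk⟩ := σ.exists_mem_Ico hη ht
    have hV := V_le hN h hα hη hτ sol (hΔ t) k ⟨hk.1, hk.2.le⟩ le_rfl
    have hx := hcV x (σ.s k) t (by linarith [σ.s_le_t k, hk.1])
    set E := Real.exp (-2 * α * (t - σ.t 0)) with hE
    have hE0 : 0 < E := Real.exp_pos _
    have h1 : c * ‖x t‖ ^ 2 ≤ E * (L * Z) + d.b / (2 * α) * essNorm ω (σ.t 0) t ^ 2 :=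
      (hx.trans hV).trans (by gcongr)
    have h2 : ‖x t‖ ^ 2 ≤ c⁻¹ * (E * (L * Z) + d.b / (2 * α) * essNorm ω (σ.t 0) t ^ 2) := by
      rw [← div_eq_inv_mul, le_div_iff₀' hc]
      exact h1
    rw [show -(2 * α) * (t - σ.t 0) = -2 * α * (t - σ.t 0) by ring, ← hE]
    calc ‖x t‖ ^ 2 ≤ c⁻¹ * (E * (L * Z) + d.b / (2 * α) * essNorm ω (σ.t 0) t ^ 2) := h2
      _ ≤ B * (E * (L * Z) + d.b / (2 * α) * essNorm ω (σ.t 0) t ^ 2) := by gcongr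
      _ ≤ B * (X * (E * (L * Z)) + d.b / (2 * α) * essNorm ω (σ.t 0) t ^ 2) := by
          have : E * (L * Z) ≤ X * (E * (L * Z)) := le_mul_of_one_le_left (by positivity) hX1
          gcongr
      _ = _ := by ring
  · have hVe := Ve_le hN h hα hη hτ sol (hΔ t) k ht.1
    have hV0 : 0 ≤ V sys ηm τM α d x (σ.s k) (σ.t k) :=
      (by positivity : 0 ≤ c * ‖x (σ.t k)‖ ^ 2).trans
        (hcV x (σ.s k) (σ.t k) (by linarith [σ.s_le_t k]))
    have hQs : ∑ i, quad (d.Q i) (e k i) ≤ Ve sys ηm τM α d x (σ.s k) (σ.t k) (e k) := by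
      rw [Ve]
      linarith
    set E := Real.exp (-2 * α * (t - σ.t 0)) with hE
    have hE0 : 0 < E := Real.exp_pos _
    have hEk : Real.exp (-2 * α * (σ.t k - σ.t 0)) ≤ X * E := by
      rw [hE, ← Real.exp_add]
      refine Real.exp_le_exp.2 ?_
      have : t - σ.t k ≤ τM := by linarith [σ.t_succ_le k, σ.s_le_t k, ht.2]
      nlinarith
    have hρ : 0 ≤ d.b / (2 * α) * essNorm ω (σ.t 0) t ^ 2 := by positivity
    have h1 : ∑ i, quad (d.Q i) (e k i) ≤
        X * E * (L * Z) + d.b / (2 * α) * essNorm ω (σ.t 0) t ^ 2 := by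
      have h2 : Real.exp (-2 * α * (σ.t k - σ.t 0)) *
          Ve sys ηm τM α d x (σ.s 0) (σ.t 0) (e 0) ≤ X * E * (L * Z) :=
        (mul_le_mul_of_nonneg_left hVe0 (Real.exp_pos _).le).trans
          (mul_le_mul_of_nonneg_right hEk (by positivity))
      have h3 := mul_nonneg hρ (Real.exp_pos (-2 * α * (σ.t k - σ.t 0))).le
      linarith
    have h2 : ∑ i, ‖e k i‖ ^ 2 ≤ (∑ i, (bQ i)⁻¹) * ∑ i, quad (d.Q i) (e k i) := by
      rw [Finset.sum_mul]
      refine Finset.sum_le_sum fun i _ => ?_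
      rw [← div_eq_inv_mul, le_div_iff₀' (hbQ i)]
      exact (hQ' i _).trans (Finset.single_le_sum (f := fun i => quad (d.Q i) (e k i))
        (fun j _ => quad_nonneg (h.Q_pos j).posSemidef _) (Finset.mem_univ i))
    rw [show -(2 * α) * (t - σ.t 0) = -2 * α * (t - σ.t 0) by ring, ← hE]
    calc ∑ i, ‖e k i‖ ^ 2 ≤ (∑ i, (bQ i)⁻¹) * ∑ i, quad (d.Q i) (e k i) := h2
      _ ≤ (∑ i, (bQ i)⁻¹) * (X * E * (L * Z) + d.b / (2 * α) * essNorm ω (σ.t 0) t ^ 2) := by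
          gcongr
      _ ≤ B * (X * E * (L * Z) + d.b / (2 * α) * essNorm ω (σ.t 0) t ^ 2) := by
          gcongr
      _ = _ := by ring

/-! ### Persistence of the matrix inequalities for small decay rates. -/

section Perturbation

/-- Compactness of the unit sphere makes the neighbourhood of $a$ uniform in the vector, and
homogeneity passes to all nonzero vectors. -/
lemma eventually_posDef {ι : Type*} [Fintype ι] {M : ℝ → Matrix ι ι ℝ} {a : ℝ}
    (hM : Continuous M) (hsymm : ∀ s, (M s).IsHermitian) (ha : (M a).PosDef) :
    ∀ᶠ s in nhds a, (M s).PosDef := by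
  have hcont : Continuous fun z : ℝ × (ι → ℝ) => z.2 ⬝ᵥ (M z.1 *ᵥ z.2) :=
    continuous_snd.dotProduct ((hM.comp continuous_fst).matrix_mulVec continuous_snd)
  have key := (isCompact_sphere (0 : ι → ℝ) 1).eventually_forall_of_forall_eventually
    (x₀ := a) (P := fun s v => 0 < v ⬝ᵥ (M s *ᵥ v)) fun v hv => by
      have hv0 : v ≠ 0 := by
        rintro rfl
        simp at hv
      exact hcont.continuousAt.eventually (lt_mem_nhds
        (by simpa using ha.dotProduct_mulVec_pos hv0))
  filter_upwards [key] with s hs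
  refine PosDef.of_dotProduct_mulVec_pos (hsymm s) fun v hv => ?_
  have hv' : 0 < ‖v‖ := norm_pos_iff.2 hv
  have h1 := hs (‖v‖⁻¹ • v) (by simp [norm_smul, hv])
  rw [mulVec_smul, dotProduct_smul, smul_dotProduct, smul_eq_mul, smul_eq_mul] at h1
  rw [star_trivial]
  have h2 := inv_pos.2 hv'
  exact pos_of_mul_pos_right (pos_of_mul_pos_right h1 h2.le) h2.le

lemma isHermitian_neg_Omega (h : Feasible sys ηm τM 0 d) (i : Fin N) :
    (-(Omega ηm τM α d i)).IsHermitian := by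
  have hQ := posSemidef_transpose_eq (h.Q_pos i).posSemidef
  have hU := posSemidef_transpose_eq (h.U_pos i).posSemidef
  have hG := posSemidef_transpose_eq (h.G_pos i).posSemidef
  rw [IsHermitian, conjTranspose_eq_transpose_of_trivial]
  simp [Omega, fromBlocks_transpose, hQ, hU, hG]

lemma isHermitian_neg_LMIMat (h : Feasible sys ηm τM 0 d) (i : Fin N) :
    (-(LMIMat sys ηm τM α d i)).IsHermitian := by
  have hP := posSemidef_transpose_eq h.P_pos.posSemidef
  have hS₀ := posSemidef_transpose_eq h.S₀_pos.posSemidef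
  have hS₁ := posSemidef_transpose_eq h.S₁_pos.posSemidef
  have hR₀ := posSemidef_transpose_eq h.R₀_pos.posSemidef
  have hR₁ := posSemidef_transpose_eq h.R₁_pos.posSemidef
  have hH : (HMat sys ηm τM d)ᵀ = HMat sys ηm τM d := by
    have hG := fun i => posSemidef_transpose_eq (h.G_pos i).posSemidef
    simp [HMat, hR₀, hR₁, hG, transpose_sum, Matrix.mul_assoc]
  have hΦ : (Phi d)ᵀ = Phi d := by
    simp [Phi, fromBlocks_transpose, hR₁]
  have hψ : ∀ j, (psi ηm τM α d j)ᵀ = psi ηm τM α d j := fun j => by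
    simp [psi, posSemidef_transpose_eq (h.Q_pos j).posSemidef,
      posSemidef_transpose_eq (h.U_pos j).posSemidef]
  have hΥ : (Upsilon ηm τM α d i)ᵀ = (Upsilon (q := q) ηm τM α d i) := by
    simp [Upsilon, fromBlocks_transpose, blockDiagonal'_transpose, hψ, hP, hS₀, hS₁]
  rw [IsHermitian, conjTranspose_eq_transpose_of_trivial]
  simp only [LMIMat, SigmaMat, transpose_neg, fromBlocks_transpose, transpose_sub, transpose_add,
    transpose_smul, transpose_mul, transpose_transpose, hH, hΦ, hΥ, hP, hR₀, Matrix.mul_assoc]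
  rw [add_comm ((Xi sys i)ᵀ * _)]

lemma continuous_Omega (i : Fin N) : Continuous fun α => -(Omega ηm τM α d i) := by
  have h : Continuous fun α => Omega ηm τM α d i := by
    refine Continuous.matrix_fromBlocks ?_ ?_ ?_ ?_ <;> fun_prop
  exact h.neg

lemma continuous_LMIMat (i : Fin N) : Continuous fun α => -(LMIMat sys ηm τM α d i) := by
  have hψ : ∀ j, Continuous fun α => psi ηm τM α d j := fun j => by
    unfold psi
    fun_prop
  have hΥ : Continuous fun α => Upsilon (q := q) ηm τM α d i := by
    refine Continuous.matrix_fromBlocks (by fun_prop) continuous_const continuous_const ?_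
    refine Continuous.matrix_fromBlocks (by fun_prop) continuous_const continuous_const ?_
    refine Continuous.matrix_fromBlocks continuous_const continuous_const continuous_const ?_
    refine Continuous.matrix_fromBlocks (by fun_prop) continuous_const continuous_const ?_
    refine Continuous.matrix_fromBlocks ?_ continuous_const continuous_const continuous_const
    exact Continuous.matrix_blockDiagonal' (continuous_pi fun j => hψ j)
  have hSig : Continuous fun α => SigmaMat sys ηm τM α d i := by
    unfold SigmaMat
    fun_prop
  have h : Continuous fun α => LMIMat sys ηm τM α d i :=
    Continuous.matrix_fromBlocks (by fun_prop) continuous_const continuous_const continuous_const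
  exact h.neg

/-- Feasibility for `α = 0` persists for small `α`. -/
lemma Feasible.eventually (h : Feasible sys ηm τM 0 d) :
    ∀ᶠ α in nhds (0 : ℝ), Feasible sys ηm τM α d := by
  have h1 := Filter.eventually_all.2 fun i => eventually_posDef (continuous_Omega i)
    (fun α => isHermitian_neg_Omega (α := α) h i) (h.Omega_neg i)
  have h2 := Filter.eventually_all.2 fun i => eventually_posDef (continuous_LMIMat i)
    (fun α => isHermitian_neg_LMIMat (α := α) h i) (h.LMI_neg i)
  filter_upwards [h1, h2] with α hα1 hα2
  -- The other conditions do not involve $\alpha$; in particular the nonstrict $\Phi\ge0$ needs no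
  -- perturbation.
  exact { h with Omega_neg := hα1, LMI_neg := hα2 }

end Perturbation

end NCS

theorem theorem1 {N n q : ℕ} {p : Fin N → ℕ} (hN : 2 ≤ N) (sys : NCS.Plant n q p)
    (ηm τM : ℝ) (hη : 0 ≤ ηm) (hτ : ηm < τM) (d : NCS.DecisionVars n p) :
    (∀ α : ℝ, 0 < α → NCS.Feasible sys ηm τM α d →
      NCS.ExpBound sys ηm τM α d ∧ NCS.ISS sys ηm τM d.Q) ∧
    (NCS.Feasible sys ηm τM 0 d →
      (∃ α₀ : ℝ, 0 < α₀ ∧ ∀ α : ℝ, 0 < α → α ≤ α₀ → NCS.ExpBound sys ηm τM α d) ∧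
      NCS.ISS sys ηm τM d.Q) := by
  refine ⟨fun α hα h => ⟨h.expBound hN hα hη hτ, h.iss hN hα hη hτ⟩, fun h => ?_⟩
  obtain ⟨ε, hε, hball⟩ := Metric.eventually_nhds_iff.1 h.eventually
  -- The ball is open and $\alpha=\alpha_0$ is allowed, hence $\alpha_0=\varepsilon/2$.
  have hfeas : ∀ α : ℝ, 0 < α → α ≤ ε / 2 → NCS.Feasible sys ηm τM α d := fun α h1 h2 =>
    hball (by rw [Real.dist_0_eq_abs, abs_of_pos h1]; linarith)
  exact ⟨⟨ε / 2, half_pos hε, fun α h1 h2 => (hfeas α h1 h2).expBound hN h1 hη hτ⟩,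
    (hfeas (ε / 2) (half_pos hε) le_rfl).iss hN (half_pos hε) hη hτ⟩
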